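/- **Programs.** Fix countably infinite sets of numerals $\bar n$ ($n\in\mathbb Z$), symbolic constants and variables, with a total order on variables. *Ground terms* are $\mathit{inf}$, the numerals, the symbolic constants and $\mathit{sup}$, with a fixed total order in which $\mathit{inf}$ is least, $\mathit{sup}$ is greatest, numerals are ordered as integers, and numerals precede symbolic constants; *terms* are ground terms and variables. An *atomic formula* is an atom $p(t_1,\dots,t_n)$ or a comparison $t\prec t'$ with ${\prec}\in\{=,\neq,<,>,\le,\ge\}$; a *basic literal* is an atomic formula preceded by zero, one or two *not*. An *aggregate element* $E$ is $t_1,\dots,t_k:l_1,\dots,l_m$ ($t_i$ terms, $l_j$ basic literals); an *aggregate literal* is an aggregate atom $\mathtt{op}\{E\}\prec u$ ($\mathtt{op}$ is $\mathtt{count}$ or $\mathtt{sum}$, $u$ a term) preceded by zero, one or two *not*. A *rule* is $\mathit{Head}\leftarrow B_1,\dots,B_n$ with $\mathit{Head}$ an atom or $\bot$ and each $B_i$ a basic or aggregate literal; a *program* is a (possibly infinite) set of rules. A variable is *global* in a rule if it occurs in the head, in a basic literal of the body, or in a guard $u$. For a set $D$ of tuples of ground terms, $\widehat{\mathtt{count}}(D)$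 is the numeral of $|D|$ if $D$ is finite and $\mathit{sup}$ otherwise; $\widehat{\mathtt{sum}}(D)$ is the numeral of the sum of the weights of the tuples in $D$ if only finitely many weights are nonzero and $\bar 0$ otherwise (the weight of a tuple is $n$ if its first member is $\bar n$, and $0$ otherwise). **Answer sets.** For a program $\Pi$, $\tau\Pi$ is the infinitary propositional formula (over ground atoms) that is the conjunction of all implications $\bigwedge_i\tau(B_i)\to\tau(\mathit{Head})$, over all rules of $\Pi$ and all substitutions of ground terms for their global variables. Here $\tau(A)=A$ for a ground atom, $\tau\bot=\bot$, a ground comparison becomes $\top$ or $\bot$, each *not* becomes $\neg$ ($\neg F$ is $F\to\bot$), and, with $\Psi$ the set of tuples of ground terms for the remaining variables $\mathbf Y$ of $E$, an aggregate atom becomes $\bigwedge_{\Delta}\big(\bigwedge_{\mathbf y\in\Delta}\mathbf l_{\mathbf y}\to\bigvee_{\mathbf y\in\Psi\setminus\Delta}\mathbf l_{\mathbf y}\big)$, where $\Delta$ ranges over the subsets of $\Psi$ for which $\widehat{\mathtt{op}}\{\mathbf t_{\mathbf y}:\mathbf y\in\Delta\}\prec u$ fails, $\mathbf t_{\mathbf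 y}$ is the instance of $\langle t_1,\dots,t_k\rangle$ and $\mathbf l_{\mathbf y}$ is the conjunction of $\tau$ of the instances of $l_1,\dots,l_m$. A set $X$ of ground atoms is a *clingo answer set* of $\Pi$ if it is a $\subseteq$-minimal model of the reduct $(\tau\Pi)^X$, where $A^X$ is $A$ if $A\in X$ and $\bot$ otherwise, the reduct commutes with conjunctions and disjunctions, and $(F\to G)^X$ is $F^X\to G^X$ if $X\models F\to G$ and $\bot$ otherwise. It is a *dlv answer set* of $\Pi$ if it is a $\subseteq$-minimal model of the FLP reduct of $\tau\Pi$, obtained by replacing with $\top$ the implications whose antecedent is not satisfied by $X$. Programs $\Pi_1,\Pi_2$ are *strongly equivalent* under one of these semantics if, for every program $\Delta$, $\Pi_1\cup\Delta$ and $\Pi_2\cup\Delta$ have the same answer sets under it. **Signature.** Let $\mathcal P$ be the set of predicate symbols $p/n$ occurring in $\Pi_1\cup\Pi_2$ (also inside aggregates). Let $\mathcal S$ be the set of pairs $E/\mathbf X$ such that $E$ occurs in some rule of $\Pi_1\cup\Pi_2$ and $\mathbf X$ is the ordered list of the variables of $E$ that are global in that rule. The signature $\sigma$ has sorts *general*,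 *tuple* and *set*; ground terms as object constants; the predicates in $\mathcal P$ and the comparisons other than $=$ on the general sort; $\in$ between tuples and sets; functions $\mathit{tuple}/k$ from general to tuple for each length $k$ of $t_1,\dots,t_k$ in $\mathcal S$; functions $\mathit{count},\mathit{sum}$ from set to general; and, for each $E/\mathbf X\in\mathcal S$, functions $s^{cli}_{E/\mathbf X}$ and $s^{dlv}_{E/\mathbf X}$ with $|\mathbf X|$ general arguments and value of sort set. Formulas may use a second negation $\sim$, with the classical clause $I\models{\sim}F$ iff $I\not\models F$. The signature $\hat\sigma$ adds a copy $\hat p$ of every $p\in\mathcal P$ and a copy $\hat s^x_{E/\mathbf X}$ of every $s^x_{E/\mathbf X}$; $\hat F$ is $F$ with all these symbols replaced by their copies. An interpretation of $\hat\sigma$ is *standard* if its general universe is the set of ground terms, its tuple universe is the (possibly empty) set of all tuples of ground terms of the lengths $k$ above, its set universe consists of subsets of the tuple universe, ground terms denote themselves, comparisons (including $\neq$) denote the relations given by identity and the fixed order, and $\mathit{tuple}/k$, $\in$, $\mathit{count}$, $\mathit{sum}$ have their intended meaning ($\mathit{count}$ and $\mathit{sum}$ that of $\widehat{\mathtt{count}}$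 and $\widehat{\mathtt{sum}}$). **Translations.** For $x\in\{cli,dlv\}$, $\tau^x R$ is the universal closure of $\bigwedge_i\tau^xB_i\to\mathit{Head}$, where atomic formulas are unchanged, $\mathtt{op}\{E\}\prec u$ becomes $\mathit{op}(s^x_{E/\mathbf X}(\mathbf X))\prec u$, and each *not* becomes $\neg$ if $x=cli$ and $\sim$ if $x=dlv$; $\tau^x\Pi$ is the set of all $\tau^xR$, $R\in\Pi$. With $NF$ obtained from $F$ by replacing every $\sim$ by $\neg$, $\gamma$ is defined by: $\gamma F=F\wedge\hat F$ for atomic $F$ (equalities included), $\gamma\bot=\bot$, $\gamma(\neg F)=\neg\hat F$, $\gamma({\sim}F)=\neg\hat F\wedge\neg NF$, $\gamma(F\to G)=(\gamma F\to\gamma G)\wedge(\hat F\to\hat G)$ for $G\ne\bot$, and $\gamma$ commutes with $\wedge,\vee,\forall,\exists$. Let $HT$ be the set of sentences $\forall\mathbf X(p(\mathbf X)\to\hat p(\mathbf X))$, $p\in\mathcal P$. Let $AGG$ be the set of the following sentences, for all $E/\mathbf X\in\mathcal S$, where $\mathbf Y$ lists the variables of $E$ not in $\mathbf X$ and $F^x$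 is $T=\mathit{tuple}(t_1,\dots,t_k)\wedge\tau^x(l_1)\wedge\dots\wedge\tau^x(l_m)$: $$\forall\mathbf X\,T\,(T\in\hat s^x_{E/\mathbf X}(\mathbf X)\leftrightarrow\exists\mathbf Y\,\hat F^x)\quad(x\in\{cli,dlv\}),$$ $$\forall\mathbf X\,T\,(T\in s^{cli}_{E/\mathbf X}(\mathbf X)\leftrightarrow\exists\mathbf Y\,\gamma(F^{cli})),\qquad \forall\mathbf X\,T\,(T\in s^{dlv}_{E/\mathbf X}(\mathbf X)\leftrightarrow\exists\mathbf Y\,N F^{dlv}).$$ **Theorem.** Finite programs $\Pi_1$ and $\Pi_2$ are strongly equivalent under the clingo semantics if and only if every standard interpretation of $\hat\sigma$ satisfies the sentence $$\bigwedge HT\wedge\bigwedge AGG\to(F_1\leftrightarrow F_2),$$ where $F_i$ is the conjunction of all sentences in $\gamma\tau^{cli}\Pi_i$. The same holds with clingo and $\tau^{cli}$ replaced by dlv and $\tau^{dlv}$. -/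

import Mathlib

namespace ASP

section Programs

/-! ## Programs with aggregates

`C` is the set of symbolic constants (with the linear order chosen on it) and `V` the set of
program variables (with its lexicographic order). -/

/-- Ground program terms: `inf`, numerals, symbolic constants, `sup`. -/
inductive Ground (C : Type) : Type
  | inf : Ground C
  | num : ℤ → Ground C
  | sym : C → Ground C
  | sup : Ground C

/-- The position of a ground term in the chain
`inf < numerals < symbolic constants < sup`. -/
def Ground.key {C : Type} : Ground C → WithBot (WithTop (ℤ ⊕ₗ C))
  | .inf => ⊥
  | .num n => ((toLex (Sum.inl n) : ℤ ⊕ₗ C) : WithTop (ℤ ⊕ₗ C))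
  | .sym c => ((toLex (Sum.inr c) : ℤ ⊕ₗ C) : WithTop (ℤ ⊕ₗ C))
  | .sup => ((⊤ : WithTop (ℤ ⊕ₗ C)) : WithBot (WithTop (ℤ ⊕ₗ C)))

theorem Ground.key_injective {C : Type} : Function.Injective (Ground.key (C := C)) := by
  intro a b h
  cases a <;> cases b <;> first | exact absurd h WithBot.bot_ne_coe | simp_all [Ground.key]

/-- The total order on ground terms: `inf` is least, `sup` is greatest, numerals are ordered as
integers, every numeral precedes every symbolic constant, and symbolic constants are ordered by
the given order on `C`. -/
noncomputable instance {C : Type} [LinearOrder C] : LinearOrder (Ground C) :=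
  LinearOrder.lift' Ground.key Ground.key_injective

/-- Program terms. -/
inductive PTerm (C V : Type) : Type
  | ground : Ground C → PTerm C V
  | var : V → PTerm C V

/-- Comparison symbols. -/
inductive Cmp : Type
  | eq | ne | lt | gt | le | ge

/-- The relation on ground terms denoted by a comparison symbol. -/
def Cmp.Holds {C : Type} [LinearOrder C] : Cmp → Ground C → Ground C → Prop
  | .eq, a, b => a = b
  | .ne, a, b => a ≠ b
  | .lt, a, b => a < b
  | .gt, a, b => a > b
  | .le, a, b => a ≤ b
  | .ge, a, b => a ≥ b

/-- Predicate symbols `p/n`. -/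
abbrev PredSym (C : Type) : Type := C × ℕ

/-- Atoms `p(t₁, …, tₙ)`. -/
structure Atom (C V : Type) : Type where
  pred : C
  args : List (PTerm C V)

/-- Atomic formulas: atoms and comparisons. -/
inductive AtomicFormula (C V : Type) : Type
  | atom : Atom C V → AtomicFormula C V
  | cmp : Cmp → PTerm C V → PTerm C V → AtomicFormula C V

/-- No occurrence, one occurrence, or two occurrences of `not`. -/
inductive Sign : Type
  | pos | neg | negneg

/-- Basic literals. -/
structure BasicLit (C V : Type) : Type where
  sign : Sign
  form : AtomicFormula C V

/-- Aggregate elements `t₁, …, tₖ : l₁, …, lₘ`. -/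
structure AggElem (C V : Type) : Type where
  terms : List (PTerm C V)
  lits : List (BasicLit C V)

/-- Operation names. -/
inductive Op : Type
  | count | sum

/-- Aggregate atoms `#op{E} ≺ u`. -/
structure AggAtom (C V : Type) : Type where
  op : Op
  elem : AggElem C V
  cmp : Cmp
  guard : PTerm C V

/-- Literals: basic literals and aggregate literals. -/
inductive Literal (C V : Type) : Type
  | basic : BasicLit C V → Literal C V
  | agg : Sign → AggAtom C V → Literal C V

/-- Rules; the head `none` stands for `⊥`. -/
structure Rule (C V : Type) : Type where
  head : Option (Atom C V)
  body : List (Literal C V)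

/-- Programs are arbitrary sets of rules. -/
abbrev Program (C V : Type) : Type := Set (Rule C V)

/-! ### Predicate symbols, variables, global variables, set symbols -/

def Atom.sym {C V : Type} (A : Atom C V) : PredSym C := (A.pred, A.args.length)

def AtomicFormula.preds {C V : Type} : AtomicFormula C V → List (PredSym C)
  | .atom A => [A.sym]
  | .cmp _ _ _ => []

def AggElem.preds {C V : Type} (E : AggElem C V) : List (PredSym C) :=
  E.lits.flatMap fun l => l.form.preds

def Literal.preds {C V : Type} : Literal C V → List (PredSym C)
  | .basic l => l.form.preds
  | .agg _ A => A.elem.preds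

/-- The predicate symbols occurring in a rule, also those inside aggregate elements. -/
def Rule.preds {C V : Type} (R : Rule C V) : List (PredSym C) :=
  (R.head.toList.map Atom.sym) ++ R.body.flatMap Literal.preds

def PTerm.vars {C V : Type} : PTerm C V → List V
  | .ground _ => []
  | .var x => [x]

def AtomicFormula.vars {C V : Type} : AtomicFormula C V → List V
  | .atom A => A.args.flatMap PTerm.vars
  | .cmp _ t u => t.vars ++ u.vars

/-- All variables occurring in an aggregate element. -/
def AggElem.vars {C V : Type} [DecidableEq V] (E : AggElem C V) : Finset V :=
  (E.terms.flatMap PTerm.vars ++ E.lits.flatMap fun l => l.form.vars).toFinset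

/-- The variables by which a literal contributes to the global variables of a rule. -/
def Literal.globals {C V : Type} : Literal C V → List V
  | .basic l => l.form.vars
  | .agg _ A => A.guard.vars

/-- Global variables of a rule: those occurring in a non-aggregate literal (the head included)
or in the guard of an aggregate literal. -/
def Rule.globals {C V : Type} [DecidableEq V] (R : Rule C V) : Finset V :=
  ((R.head.toList.flatMap fun A => A.args.flatMap PTerm.vars) ++
    R.body.flatMap Literal.globals).toFinset

/-- A set symbol `E/𝐗`. -/
structure SetSym (C V : Type) : Type where
  elem : AggElem C V
  vars : List V

/-- `E/𝐗`, where `𝐗` is the ordered list of all variables in `E` that belong to `Z`. -/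
def AggElem.setSym {C V : Type} [LinearOrder V] (E : AggElem C V) (Z : Finset V) : SetSym C V :=
  ⟨E, (E.vars ∩ Z).sort⟩

/-- The ordered list `𝐘` of the variables of `E` that are not in `𝐗`. -/
def SetSym.locals {C V : Type} [LinearOrder V] (e : SetSym C V) : List V :=
  (e.elem.vars \ e.vars.toFinset).sort

def Literal.setSyms {C V : Type} [LinearOrder V] (Z : Finset V) : Literal C V → List (SetSym C V)
  | .basic _ => []
  | .agg _ A => [A.elem.setSym Z]

/-- The set symbols occurring in a rule. -/
def Rule.setSyms {C V : Type} [LinearOrder V] (R : Rule C V) : List (SetSym C V) :=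
  R.body.flatMap (Literal.setSyms R.globals)

/-! ### Aggregate operations -/

/-- The weight of a tuple of ground terms. -/
def weight {C : Type} : List (Ground C) → ℤ
  | .num n :: _ => n
  | _ => 0

open Classical in
/-- The functions associated with the operation names. -/
noncomputable def Op.eval {C : Type} : Op → Set (List (Ground C)) → Ground C
  | .count, D => if D.Finite then .num D.ncard else .sup
  | .sum, D =>
      if h : {t ∈ D | weight t ≠ 0}.Finite then .num (∑ t ∈ h.toFinset, weight t) else .num 0

end Programs

section Infinitary

/-! ## Infinitary propositional formulas, answer sets and strong equivalence -/

/-- Infinitary propositional formulas over the set `A` of atoms; the conjunction or disjunction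
of a set of formulas is given by an indexing of that set. -/
inductive Inf (A : Type) : Type 1
  | atom : A → Inf A
  | conj {ι : Type} : (ι → Inf A) → Inf A
  | disj {ι : Type} : (ι → Inf A) → Inf A
  | imp : Inf A → Inf A → Inf A

def Inf.bot {A : Type} : Inf A := .disj (Empty.elim : Empty → Inf A)

def Inf.top {A : Type} : Inf A := .conj (Empty.elim : Empty → Inf A)

def Inf.neg {A : Type} (F : Inf A) : Inf A := .imp F .bot

/-- The conjunction of the members of a list. -/
def Inf.conjList {A : Type} (L : List (Inf A)) : Inf A := .conj fun i : Fin L.length => L.get i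

/-- Satisfaction of an infinitary formula by a set of atoms. -/
def Inf.Sat {A : Type} (X : Set A) : Inf A → Prop
  | .atom a => a ∈ X
  | .conj f => ∀ i, (f i).Sat X
  | .disj f => ∃ i, (f i).Sat X
  | .imp F G => F.Sat X → G.Sat X

open Classical in
/-- The (Ferraris–Truszczyński) reduct of a formula with respect to a set of atoms. -/
noncomputable def Inf.ftReduct {A : Type} (X : Set A) : Inf A → Inf A
  | .atom a => if a ∈ X then .atom a else .bot
  | .conj f => .conj fun i => (f i).ftReduct X
  | .disj f => .disj fun i => (f i).ftReduct X
  | .imp F G => if (Inf.imp F G).Sat X then .imp (F.ftReduct X) (G.ftReduct X) else .bot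

open Classical in
/-- The FLP reduct. It concerns implications, and conjunctions (of conjunctions) of implications,
and is taken to leave other formulas unchanged. -/
noncomputable def Inf.flpReduct {A : Type} (X : Set A) : Inf A → Inf A
  | .atom a => .atom a
  | .conj f => .conj fun i => (f i).flpReduct X
  | .disj f => .disj f
  | .imp F G => if F.Sat X then .imp F G else .top

/-- `X` is a `⊆`-minimal model of `F`. -/
def Inf.IsMinimalModel {A : Type} (X : Set A) (F : Inf A) : Prop :=
  F.Sat X ∧ ∀ Y : Set A, Y ⊂ X → ¬ F.Sat Y

/-- Ground atoms. -/
abbrev GAtom (C : Type) : Type := C × List (Ground C)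

/-- The value of a program term after substituting ground terms for its variables. -/
def PTerm.inst {C V : Type} (z : V → Ground C) : PTerm C V → Ground C
  | .ground g => g
  | .var x => z x

def Atom.inst {C V : Type} (z : V → Ground C) (A : Atom C V) : GAtom C :=
  (A.pred, A.args.map (PTerm.inst z))

def Sign.applyInf {A : Type} : Sign → Inf A → Inf A
  | .pos, F => F
  | .neg, F => F.neg
  | .negneg, F => F.neg.neg

open Classical in
/-- `τ` of the instance of an atomic formula. -/
noncomputable def AtomicFormula.tau {C V : Type} [LinearOrder C] (z : V → Ground C) :
    AtomicFormula C V → Inf (GAtom C)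
  | .atom A => .atom (A.inst z)
  | .cmp c t u => if c.Holds (t.inst z) (u.inst z) then .top else .bot

noncomputable def BasicLit.tau {C V : Type} [LinearOrder C] (z : V → Ground C)
    (l : BasicLit C V) : Inf (GAtom C) :=
  l.sign.applyInf (l.form.tau z)

/-- The set `Ψ_E` of tuples of ground terms for the local variables of `E`, where `Z` is the set
of global variables. -/
abbrev AggElem.Psi {C V : Type} [DecidableEq V] (E : AggElem C V) (Z : Finset V) : Type :=
  {x : V // x ∈ E.vars \ Z} → Ground C

/-- Substitute `y` for the local variables and `z` for the others. -/
def AggElem.extend {C V : Type} [DecidableEq V] (E : AggElem C V) (Z : Finset V)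
    (z : V → Ground C) (y : E.Psi Z) : V → Ground C :=
  fun x => if h : x ∈ E.vars \ Z then y ⟨x, h⟩ else z x

/-- `Δ` justifies the (instance of the) aggregate atom. -/
def AggAtom.Justifies {C V : Type} [LinearOrder C] [DecidableEq V] (A : AggAtom C V)
    (Z : Finset V) (z : V → Ground C) (Δ : Set (A.elem.Psi Z)) : Prop :=
  A.cmp.Holds
    (A.op.eval ((fun y => A.elem.terms.map (PTerm.inst (A.elem.extend Z z y))) '' Δ))
    (A.guard.inst z)

/-- `τ` of the instance of an aggregate atom: the conjunction, over all sets `Δ` that do not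
justify it, of the implications from the conjunction of the instances of `l₁, …, lₘ` for the
tuples in `Δ` to the disjunction of those for the tuples outside `Δ`. -/
noncomputable def AggAtom.tau {C V : Type} [LinearOrder C] [DecidableEq V] (Z : Finset V)
    (z : V → Ground C) (A : AggAtom C V) : Inf (GAtom C) :=
  .conj fun Δ : {Δ : Set (A.elem.Psi Z) // ¬ A.Justifies Z z Δ} =>
    .imp
      (.conj fun y : {y // y ∈ Δ.1} =>
        .conjList (A.elem.lits.map (BasicLit.tau (A.elem.extend Z z y.1))))
      (.disj fun y : {y // y ∉ Δ.1} =>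
        .conjList (A.elem.lits.map (BasicLit.tau (A.elem.extend Z z y.1))))

noncomputable def Literal.tau {C V : Type} [LinearOrder C] [DecidableEq V] (Z : Finset V)
    (z : V → Ground C) : Literal C V → Inf (GAtom C)
  | .basic l => l.tau z
  | .agg s A => s.applyInf (A.tau Z z)

def headTau {C V : Type} (z : V → Ground C) : Option (Atom C V) → Inf (GAtom C)
  | none => .bot
  | some A => .atom (A.inst z)

/-- `τR`: the conjunction of all ground instances of the rule. The instances are indexed by
substitutions defined on all variables; only the values on the global variables matter. -/
noncomputable def Rule.tau {C V : Type} [LinearOrder C] [DecidableEq V] (R : Rule C V) :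
    Inf (GAtom C) :=
  .conj fun z : V → Ground C =>
    .imp (.conjList (R.body.map (Literal.tau R.globals z))) (headTau z R.head)

/-- `τPg`. -/
noncomputable def Program.tau {C V : Type} [LinearOrder C] [DecidableEq V] (Pg : Program C V) :
    Inf (GAtom C) :=
  .conj fun R : {R // R ∈ Pg} => R.1.tau

/-- The two semantics. -/
inductive Sem : Type
  | cli | dlv

/-- `X` is a clingo (resp. dlv) answer set of `Pg`. -/
def IsAnswerSet {C V : Type} [LinearOrder C] [DecidableEq V] (Pg : Program C V)
    (X : Set (GAtom C)) : Sem → Prop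
  | .cli => Inf.IsMinimalModel X ((Program.tau Pg).ftReduct X)
  | .dlv => Inf.IsMinimalModel X ((Program.tau Pg).flpReduct X)

/-- Strong equivalence under the semantics `s`. -/
def StronglyEquivalent {C V : Type} [LinearOrder C] [DecidableEq V] (s : Sem)
    (Pg₁ Pg₂ : Program C V) : Prop :=
  ∀ (Δ : Program C V) (X : Set (GAtom C)), IsAnswerSet (Pg₁ ∪ Δ) X s ↔ IsAnswerSet (Pg₂ ∪ Δ) X s

end Infinitary

section FirstOrder

/-! ## The three-sorted first-order language -/

/-- The sorts: general, tuple, set. -/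
inductive Srt : Type
  | gen | tuple | set

/-- The sets `𝒫` and `𝒮` of predicate and set symbols of a signature `σ(𝒫, 𝒮)`. -/
structure Sig (C V : Type) : Type where
  P : Finset (PredSym C)
  S : Finset (SetSym C V)
  closed : ∀ e ∈ S, ∀ p ∈ e.elem.preds, p ∈ P

/-- The lengths `k` of the lists `t₁, …, tₖ` of the set symbols in `𝒮`. -/
def Sig.tupleArities {C V : Type} (σ : Sig C V) : Set ℕ :=
  {k | ∃ e ∈ σ.S, e.elem.terms.length = k}

open Classical in
/-- The signature of all predicate and set symbols that occur in a finite program. -/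
noncomputable def Sig.ofProgram {C V : Type} [LinearOrder V] (Pg : Finset (Rule C V)) :
    Sig C V where
  P := Pg.biUnion fun R => R.preds.toFinset
  S := Pg.biUnion fun R => R.setSyms.toFinset
  closed := by
    intro e he p hp
    simp only [Finset.mem_biUnion, List.mem_toFinset, Rule.setSyms, List.mem_flatMap] at he
    obtain ⟨R, hR, l, hl, hel⟩ := he
    simp only [Finset.mem_biUnion, List.mem_toFinset]
    refine ⟨R, hR, ?_⟩
    cases l with
    | basic l => simp [Literal.setSyms] at hel
    | agg s A =>
      simp only [Literal.setSyms, List.mem_singleton] at hel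
      subst hel
      exact List.mem_append_right _ (List.mem_flatMap.2 ⟨_, hl, hp⟩)

/-- Object variables: program variables are those of the general sort. -/
@[reducible] def Var (V : Type) : Srt → Type
  | .gen => V
  | .tuple => ℕ
  | .set => ℕ

/-- Terms. Every intensional symbol (predicate symbols in `𝒫` and the function symbols of set
symbols) comes in one copy for each element of `M`: the signature `σ` is the case `M = Unit`, and
the extended signature `σ̂` is the case `M = Mark` below. -/
inductive Term {C V : Type} (σ : Sig C V) (M : Type) : Srt → Type
  | var {s : Srt} (x : Var V s) : Term σ M s
  | const (g : Ground C) : Term σ M .gen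
  | tuple (k : ℕ) (hk : k ∈ σ.tupleArities) (ts : Fin k → Term σ M .gen) : Term σ M .tuple
  | agg (op : Op) (t : Term σ M .set) : Term σ M .gen
  | setFn (m : M) (x : Sem) (e : SetSym C V) (he : e ∈ σ.S)
      (ts : Fin e.vars.length → Term σ M .gen) : Term σ M .set

/-- Extended first-order formulas; `sneg` is the second negation. -/
inductive Formula {C V : Type} (σ : Sig C V) (M : Type) : Type
  | bot : Formula σ M
  | atom (m : M) (p : PredSym C) (hp : p ∈ σ.P) (ts : Fin p.2 → Term σ M .gen) : Formula σ M
  | eq {s : Srt} (t u : Term σ M s) : Formula σ M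
  | cmp (c : Cmp) (hc : c ≠ .eq) (t u : Term σ M .gen) : Formula σ M
  | mem (t : Term σ M .tuple) (A : Term σ M .set) : Formula σ M
  | sneg (F : Formula σ M) : Formula σ M
  | and (F G : Formula σ M) : Formula σ M
  | or (F G : Formula σ M) : Formula σ M
  | imp (F G : Formula σ M) : Formula σ M
  | all {s : Srt} (x : Var V s) (F : Formula σ M) : Formula σ M
  | ex {s : Srt} (x : Var V s) (F : Formula σ M) : Formula σ M

namespace Formula

variable {C V : Type} {σ : Sig C V} {M : Type}

def neg (F : Formula σ M) : Formula σ M := .imp F .bot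

def iff (F G : Formula σ M) : Formula σ M := .and (.imp F G) (.imp G F)

/-- The conjunction of a finite list of formulas. -/
def conj : List (Formula σ M) → Formula σ M
  | [] => neg .bot
  | [F] => F
  | F :: G :: L => .and F (conj (G :: L))

/-- Universal quantification over a list of variables of the general sort. -/
def allGen (X : List V) (F : Formula σ M) : Formula σ M :=
  X.foldr (fun x G => .all (s := .gen) x G) F

/-- Existential quantification over a list of variables of the general sort. -/
def exGen (X : List V) (F : Formula σ M) : Formula σ M :=
  X.foldr (fun x G => .ex (s := .gen) x G) F

end Formula

/-! ### Interpretations and satisfaction -/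

/-- Interpretations of the signature (universes may be empty; the universe of tuples of a standard
interpretation is empty when there are no set symbols). -/
structure Interp {C V : Type} (σ : Sig C V) (M : Type) : Type 1 where
  carrier : Srt → Type
  const : Ground C → carrier .gen
  tuple : (k : ℕ) → k ∈ σ.tupleArities → (Fin k → carrier .gen) → carrier .tuple
  agg : Op → carrier .set → carrier .gen
  setFn : M → Sem → (e : SetSym C V) → e ∈ σ.S → (Fin e.vars.length → carrier .gen) → carrier .set
  pred : M → (p : PredSym C) → p ∈ σ.P → (Fin p.2 → carrier .gen) → Prop
  cmp : (c : Cmp) → c ≠ .eq → carrier .gen → carrier .gen → Prop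
  mem : carrier .tuple → carrier .set → Prop

/-- Variables together with their sorts. -/
abbrev SVar (V : Type) : Type := Σ s : Srt, Var V s

/-- The variable `v` occurs in a term. -/
def Term.Occurs {C V : Type} {σ : Sig C V} {M : Type} (v : SVar V) :
    {s : Srt} → Term σ M s → Prop
  | s, .var x => v = ⟨s, x⟩
  | _, .const _ => False
  | _, .tuple _ _ ts => ∃ i, (ts i).Occurs v
  | _, .agg _ t => t.Occurs v
  | _, .setFn _ _ _ _ ts => ∃ i, (ts i).Occurs v

/-- The variable `v` occurs free in a formula. -/
def Formula.Free {C V : Type} {σ : Sig C V} {M : Type} (v : SVar V) : Formula σ M → Prop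
  | .bot => False
  | .atom _ _ _ ts => ∃ i, (ts i).Occurs v
  | .eq t u => t.Occurs v ∨ u.Occurs v
  | .cmp _ _ t u => t.Occurs v ∨ u.Occurs v
  | .mem t A => t.Occurs v ∨ A.Occurs v
  | .sneg F => F.Free v
  | .and F G => F.Free v ∨ G.Free v
  | .or F G => F.Free v ∨ G.Free v
  | .imp F G => F.Free v ∨ G.Free v
  | .all (s := s) x F => F.Free v ∧ v ≠ ⟨s, x⟩
  | .ex (s := s) x F => F.Free v ∧ v ≠ ⟨s, x⟩

/-- The value of a term under an assignment of its variables. -/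
def Term.eval {C V : Type} {σ : Sig C V} {M : Type} (I : Interp σ M) :
    {s : Srt} → (t : Term σ M s) → ((v : SVar V) → t.Occurs v → I.carrier v.1) → I.carrier s
  | s, .var x, ρ => ρ ⟨s, x⟩ rfl
  | _, .const g, _ => I.const g
  | _, .tuple k hk ts, ρ => I.tuple k hk fun i => (ts i).eval I fun v hv => ρ v ⟨i, hv⟩
  | _, .agg op t, ρ => I.agg op (t.eval I ρ)
  | _, .setFn m x e he ts, ρ => I.setFn m x e he fun i => (ts i).eval I fun v hv => ρ v ⟨i, hv⟩

open Classical in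
/-- Extend an assignment of all variables other than `⟨s, x⟩` by the value `d` for `⟨s, x⟩`. -/
noncomputable def updateAssignment {V : Type} {D : Srt → Type} {Q : SVar V → Prop} {s : Srt}
    (x : Var V s) (d : D s) (ρ : (v : SVar V) → Q v ∧ v ≠ ⟨s, x⟩ → D v.1) :
    (v : SVar V) → Q v → D v.1 :=
  fun v hv => if h : v = ⟨s, x⟩ then cast (by rw [h]) d else ρ v ⟨hv, h⟩

/-- Classical satisfaction of a formula under an assignment of its free variables. -/
def Formula.Sat {C V : Type} {σ : Sig C V} {M : Type} (I : Interp σ M) :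
    (F : Formula σ M) → ((v : SVar V) → F.Free v → I.carrier v.1) → Prop
  | .bot, _ => False
  | .atom m p hp ts, ρ => I.pred m p hp fun i => (ts i).eval I fun v hv => ρ v ⟨i, hv⟩
  | .eq t u, ρ => t.eval I (fun v hv => ρ v (.inl hv)) = u.eval I (fun v hv => ρ v (.inr hv))
  | .cmp c hc t u, ρ =>
      I.cmp c hc (t.eval I fun v hv => ρ v (.inl hv)) (u.eval I fun v hv => ρ v (.inr hv))
  | .mem t A, ρ => I.mem (t.eval I fun v hv => ρ v (.inl hv)) (A.eval I fun v hv => ρ v (.inr hv))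
  | .sneg F, ρ => ¬ F.Sat I ρ
  | .and F G, ρ => F.Sat I (fun v hv => ρ v (.inl hv)) ∧ G.Sat I (fun v hv => ρ v (.inr hv))
  | .or F G, ρ => F.Sat I (fun v hv => ρ v (.inl hv)) ∨ G.Sat I (fun v hv => ρ v (.inr hv))
  | .imp F G, ρ => F.Sat I (fun v hv => ρ v (.inl hv)) → G.Sat I (fun v hv => ρ v (.inr hv))
  | .all (s := s) x F, ρ => ∀ d : I.carrier s, F.Sat I (updateAssignment x d ρ)
  | .ex (s := s) x F, ρ => ∃ d : I.carrier s, F.Sat I (updateAssignment x d ρ)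

/-- `I ⊨ F`. For a sentence `F` there is exactly one assignment of its free variables. -/
def Interp.Models {C V : Type} {σ : Sig C V} {M : Type} (I : Interp σ M) (F : Formula σ M) : Prop :=
  ∀ ρ : (v : SVar V) → F.Free v → I.carrier v.1, F.Sat I ρ

/-! ### Standard interpretations -/

/-- The universe of the tuple sort of standard interpretations. -/
def Sig.tupleUniverse {C V : Type} (σ : Sig C V) : Set (List (Ground C)) :=
  {t | t.length ∈ σ.tupleArities}

/-- The data by which standard interpretations of one signature differ: the universe of the set
sort, which consists of sets of tuples, and the interpretation of the intensional symbols. -/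
structure StandardInterp {C V : Type} (σ : Sig C V) (M : Type) : Type where
  sets : Set (Set (List (Ground C)))
  sets_subset : ∀ A ∈ sets, A ⊆ σ.tupleUniverse
  setFn : M → Sem → (e : SetSym C V) → e ∈ σ.S → (Fin e.vars.length → Ground C) → {A // A ∈ sets}
  pred : M → (p : PredSym C) → p ∈ σ.P → (Fin p.2 → Ground C) → Prop

/-- The universes of a standard interpretation. -/
@[reducible] def StandardInterp.univ {C V : Type} {σ : Sig C V} {M : Type}
    (J : StandardInterp σ M) : Srt → Type
  | .gen => Ground C
  | .tuple => {t : List (Ground C) // t ∈ σ.tupleUniverse}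
  | .set => {A : Set (List (Ground C)) // A ∈ J.sets}

/-- A standard interpretation as an interpretation. -/
noncomputable def StandardInterp.toInterp {C V : Type} [LinearOrder C] {σ : Sig C V} {M : Type}
    (J : StandardInterp σ M) : Interp σ M where
  carrier := J.univ
  const g := g
  tuple k hk ds := ⟨List.ofFn ds, by simpa [Sig.tupleUniverse] using hk⟩
  agg op A := op.eval A.1
  setFn := J.setFn
  pred := J.pred
  cmp c _ a b := c.Holds a b
  mem t A := t.1 ∈ A.1

/-! ### The translations `τ^cli` and `τ^dlv` -/

section Translations

variable {C V : Type} (σ : Sig C V)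

def PTerm.toTerm (M : Type) : PTerm C V → Term σ M .gen
  | .ground g => .const g
  | .var x => .var (s := .gen) x

open Classical in
/-- `t ≺ u`, as an equality or as an atom with a comparison predicate. -/
noncomputable def cmpFormula {σ : Sig C V} {M : Type} (c : Cmp) (t u : Term σ M .gen) :
    Formula σ M :=
  if h : c = .eq then .eq t u else .cmp c h t u

def Atom.toFormula (A : Atom C V) (h : A.sym ∈ σ.P) : Formula σ Unit :=
  .atom () A.sym h fun i => (A.args.get i).toTerm σ Unit

noncomputable def AtomicFormula.toFormula :
    (A : AtomicFormula C V) → (∀ p ∈ A.preds, p ∈ σ.P) → Formula σ Unit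
  | .atom A, h => A.toFormula σ (h _ (by simp [AtomicFormula.preds]))
  | .cmp c t u, _ => cmpFormula c (t.toTerm σ Unit) (u.toTerm σ Unit)

/-- The default negation of each of the two semantics. -/
def Sem.neg {M : Type} : Sem → Formula σ M → Formula σ M
  | .cli, F => F.neg
  | .dlv, F => .sneg F

def Sign.apply {M : Type} (x : Sem) : Sign → Formula σ M → Formula σ M
  | .pos, F => F
  | .neg, F => x.neg σ F
  | .negneg, F => x.neg σ (x.neg σ F)

noncomputable def BasicLit.toFormula (x : Sem) (l : BasicLit C V)
    (h : ∀ p ∈ l.form.preds, p ∈ σ.P) : Formula σ Unit :=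
  l.sign.apply σ x (l.form.toFormula σ h)

/-- The term `s^x_{|E/𝐗|}(𝐗)`. -/
def SetSym.toTerm {M : Type} (m : M) (x : Sem) (e : SetSym C V) (he : e ∈ σ.S) :
    Term σ M .set :=
  .setFn m x e he fun i => .var (s := .gen) (e.vars.get i)

variable [LinearOrder V]

/-- `τ^x_𝐙` of an aggregate atom: `op(s^x_{|E/𝐗|}(𝐗)) ≺ u`. -/
noncomputable def AggAtom.toFormula (x : Sem) (Z : Finset V) (A : AggAtom C V)
    (h : A.elem.setSym Z ∈ σ.S) : Formula σ Unit :=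
  cmpFormula A.cmp (.agg A.op ((A.elem.setSym Z).toTerm σ () x h)) (A.guard.toTerm σ Unit)

noncomputable def Literal.toFormula (x : Sem) (Z : Finset V) : (l : Literal C V) →
    (∀ p ∈ l.preds, p ∈ σ.P) → (∀ e ∈ l.setSyms Z, e ∈ σ.S) → Formula σ Unit
  | .basic l, hP, _ => l.toFormula σ x hP
  | .agg s A, _, hS =>
      s.apply σ x (A.toFormula σ x Z (hS _ (by simp [Literal.setSyms])))

/-- All predicate and set symbols of the rule belong to the signature. -/
def Rule.Over (R : Rule C V) : Prop :=
  (∀ p ∈ R.preds, p ∈ σ.P) ∧ ∀ e ∈ R.setSyms, e ∈ σ.S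

def headFormula : (o : Option (Atom C V)) → (∀ A ∈ o, A.sym ∈ σ.P) → Formula σ Unit
  | none, _ => .bot
  | some A, h => A.toFormula σ (h A rfl)

/-- `τ^x R`. -/
noncomputable def Rule.toFormula (x : Sem) (R : Rule C V) (h : R.Over σ) : Formula σ Unit :=
  .allGen R.globals.sort <|
    .imp
      (.conj <| R.body.attach.map fun l => l.1.toFormula σ x R.globals
        (fun p hp => h.1 p (List.mem_append_right _ (List.mem_flatMap.2 ⟨_, l.2, hp⟩)))
        (fun e he => h.2 e (List.mem_flatMap.2 ⟨_, l.2, he⟩)))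
      (headFormula σ R.head fun A hA => h.1 _ <| List.mem_append_left _ <|
        List.mem_map.2 ⟨A, Option.mem_toList.2 hA, rfl⟩)

/-- The sentences of `τ^x Pg`, for a finite program `Pg`. -/
noncomputable def tauSentences (x : Sem) (Pg : Finset (Rule C V)) (h : ∀ R ∈ Pg, R.Over σ) :
    List (Formula σ Unit) :=
  Pg.attach.toList.map fun R => R.1.toFormula σ x (h R.1 R.2)

end Translations

/-! ### From here-and-there to classical logic -/

section Classical

/-- The two copies of each intensional symbol in `σ̂`: the symbol itself and its hatted copy. -/
inductive Mark : Type
  | plain | hat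

variable {C V : Type} {σ : Sig C V}

/-- Replace every intensional symbol by its copy `m`. -/
def Term.mark {M M' : Type} (m : M') : {s : Srt} → Term σ M s → Term σ M' s
  | _, .var x => .var x
  | _, .const g => .const g
  | _, .tuple k hk ts => .tuple k hk fun i => (ts i).mark m
  | _, .agg op t => .agg op (t.mark m)
  | _, .setFn _ x e he ts => .setFn m x e he fun i => (ts i).mark m

/-- Replace every intensional symbol by its copy `m`. -/
def Formula.mark {M M' : Type} (m : M') : Formula σ M → Formula σ M'
  | .bot => .bot
  | .atom _ p hp ts => .atom m p hp fun i => (ts i).mark m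
  | .eq t u => .eq (t.mark m) (u.mark m)
  | .cmp c hc t u => .cmp c hc (t.mark m) (u.mark m)
  | .mem t A => .mem (t.mark m) (A.mark m)
  | .sneg F => .sneg (F.mark m)
  | .and F G => .and (F.mark m) (G.mark m)
  | .or F G => .or (F.mark m) (G.mark m)
  | .imp F G => .imp (F.mark m) (G.mark m)
  | .all x F => .all x (F.mark m)
  | .ex x F => .ex x (F.mark m)

/-- A formula of `σ`, seen as a formula of `σ̂`. -/
def Formula.plain (F : Formula σ Unit) : Formula σ Mark := F.mark .plain

/-- `F̂`. -/
def Formula.hat (F : Formula σ Unit) : Formula σ Mark := F.mark .hat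

/-- `N F`: replace all occurrences of the second negation by the first one. -/
def Formula.N {M : Type} : Formula σ M → Formula σ M
  | .sneg F => .neg F.N
  | .and F G => .and F.N G.N
  | .or F G => .or F.N G.N
  | .imp F G => .imp F.N G.N
  | .all x F => .all x F.N
  | .ex x F => .ex x F.N
  | F => F

/-- `γ`. The clause for `F → ⊥` is the one for `¬F`. -/
def Formula.gamma : Formula σ Unit → Formula σ Mark
  | .bot => .bot
  | .atom m p hp ts => .and (plain (.atom m p hp ts)) (hat (.atom m p hp ts))
  | .eq t u => .and (plain (.eq t u)) (hat (.eq t u))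
  | .cmp c hc t u => .and (plain (.cmp c hc t u)) (hat (.cmp c hc t u))
  | .mem t A => .and (plain (.mem t A)) (hat (.mem t A))
  | .sneg F => .and (.neg F.hat) (.neg F.N.plain)
  | .and F G => .and F.gamma G.gamma
  | .or F G => .or F.gamma G.gamma
  | .imp F .bot => .neg F.hat
  | .imp F G => .and (.imp F.gamma G.gamma) (.imp F.hat G.hat)
  | .all x F => .all x F.gamma
  | .ex x F => .ex x F.gamma

/-- The first `n` object variables of the general sort. -/
noncomputable def firstVars (V : Type) [Infinite V] (n : ℕ) : List V :=
  List.ofFn fun i : Fin n => Infinite.natEmbedding V i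

/-- The sentence `∀𝐗 (p(𝐗) → p̂(𝐗))`. -/
noncomputable def htSentence [Infinite V] (p : PredSym C) (hp : p ∈ σ.P) : Formula σ Mark :=
  let args : Fin p.2 → Term σ Mark .gen := fun i => .var (s := .gen) (Infinite.natEmbedding V i)
  .allGen (firstVars V p.2) (.imp (.atom .plain p hp args) (.atom .hat p hp args))

/-- The set `HT`, listed. -/
noncomputable def HT (σ : Sig C V) [Infinite V] : List (Formula σ Mark) :=
  σ.P.attach.toList.map fun p => htSentence p.1 p.2

/-- The object variable `T` of the tuple sort. -/
def varT {M : Type} : Term σ M .tuple := .var (s := .tuple) (0 : ℕ)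

/-- `F^x`, that is, `T = tuple(t₁, …, tₖ) ∧ τ^x(l₁) ∧ ⋯ ∧ τ^x(lₘ)`. -/
noncomputable def elemFormula (x : Sem) (e : SetSym C V) (he : e ∈ σ.S) : Formula σ Unit :=
  .conj <|
    .eq varT (.tuple e.elem.terms.length ⟨e, he, rfl⟩ fun i => (e.elem.terms.get i).toTerm σ Unit) ::
    e.elem.lits.attach.map fun l => l.1.toFormula σ x fun p hp =>
      σ.closed e he p (List.mem_flatMap.2 ⟨_, l.2, hp⟩)

variable [LinearOrder V]

/-- `∀𝐗 T (T ∈ s(𝐗) ↔ ∃𝐘 G)`, where `s` is the copy `m` of `s^x_{|E/𝐗|}`. -/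
def aggSentence (m : Mark) (x : Sem) (e : SetSym C V) (he : e ∈ σ.S) (G : Formula σ Mark) :
    Formula σ Mark :=
  .allGen e.vars <| .all (s := .tuple) (0 : ℕ) <|
    .iff (.mem varT (e.toTerm σ m x he)) (.exGen e.locals G)

variable (σ)

/-- The set `AGG`, listed. -/
noncomputable def AGG : List (Formula σ Mark) :=
  σ.S.attach.toList.flatMap fun e =>
    [aggSentence .hat .cli e.1 e.2 (elemFormula .cli e.1 e.2).hat,
     aggSentence .hat .dlv e.1 e.2 (elemFormula .dlv e.1 e.2).hat,
     aggSentence .plain .cli e.1 e.2 (elemFormula .cli e.1 e.2).gamma,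
     aggSentence .plain .dlv e.1 e.2 (elemFormula .dlv e.1 e.2).N.plain]

/-- The conjunction of all sentences in `γ τ^x Pg`. -/
noncomputable def gammaTau (x : Sem) (Pg : Finset (Rule C V)) (h : ∀ R ∈ Pg, R.Over σ) :
    Formula σ Mark :=
  .conj ((tauSentences σ x Pg h).map Formula.gamma)

end Classical

open Classical in
/-- The signature `σ(𝒫, 𝒮)` for two programs `Pg₁` and `Pg₂`: all predicate and set symbols that
occur in `Pg₁ ∪ Pg₂`. -/
noncomputable def sig {C V : Type} [LinearOrder V] (Pg₁ Pg₂ : Finset (Rule C V)) : Sig C V :=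
  Sig.ofProgram (Pg₁ ∪ Pg₂)

theorem over_ofProgram {C V : Type} [LinearOrder V] {Pg : Finset (Rule C V)} {R : Rule C V}
    (hR : R ∈ Pg) : R.Over (Sig.ofProgram Pg) := by
  classical
  constructor
  · intro p hp
    exact Finset.mem_biUnion.2 ⟨R, hR, by simpa using hp⟩
  · intro e he
    exact Finset.mem_biUnion.2 ⟨R, hR, by simpa using he⟩

theorem over_left {C V : Type} [LinearOrder V] (Pg₁ Pg₂ : Finset (Rule C V)) :
    ∀ R ∈ Pg₁, R.Over (sig Pg₁ Pg₂) := by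
  classical
  exact fun R hR => over_ofProgram (Finset.mem_union_left _ hR)

theorem over_right {C V : Type} [LinearOrder V] (Pg₁ Pg₂ : Finset (Rule C V)) :
    ∀ R ∈ Pg₂, R.Over (sig Pg₁ Pg₂) := by
  classical
  exact fun R hR => over_ofProgram (Finset.mem_union_right _ hR)

/-- The sentence `⋀HT ∧ ⋀AGG → (F₁ ↔ F₂)`, where `Fᵢ` is the conjunction of `γ τ^x Pgᵢ`. -/
noncomputable def equivSentence {C V : Type} [LinearOrder V] [Infinite V] (x : Sem)
    (Pg₁ Pg₂ : Finset (Rule C V)) : Formula (sig Pg₁ Pg₂) Mark :=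
  .imp (.and (.conj (HT (sig Pg₁ Pg₂))) (.conj (AGG (sig Pg₁ Pg₂))))
    (.iff (gammaTau (sig Pg₁ Pg₂) x Pg₁ (over_left Pg₁ Pg₂))
      (gammaTau (sig Pg₁ Pg₂) x Pg₂ (over_right Pg₁ Pg₂)))

end FirstOrder

end ASP

/-! Strong equivalence depends only on pairs of sets of atoms `Y ⊆ X`. By `stronglyEquivalent_iff`,
two programs are strongly equivalent exactly when, for all such pairs, the reduct with respect to
`X` is satisfied by both `X` and `Y` for one program iff it is for the other. The separating
programs consist only of facts and rules `b ← a`, so the argument uses nothing about a semantics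
except how its reduct treats such rules and unions.

A standard interpretation encodes a pair: the hatted predicates describe `X`, the plain ones
describe `Y`, and `HT` says `Y ⊆ X`. Given the pair, `AGG` explicitly defines every set function
(`Describes.models_AGG`). Hatted functions collect the tuples produced classically in `X`. Plain
clingo functions use here-and-there satisfaction in `⟨Y, X⟩`, and plain dlv functions use classical
satisfaction in `Y`.

The infinitary formula of an aggregate atom asks for an implication for every non-justifying set.
Such an implication can fail only for the set of all tuples whose conditions hold, so the formula
says that this one set justifies the atom (`AggAtom.justifies_setOf_iff`). The first-order
comparison says the same about the value of the set function. Hence `γ` of a translated literal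
means here-and-there satisfaction for clingo and satisfaction in both `X` and `Y` for dlv. For a
whole rule, `Determines.models_gamma_rule` identifies `γ` with the condition on the pair, and
`stronglyEquivalent_iff_models` combines the two halves. -/

namespace ASP

section Infinitary

/-! ## Here-and-there satisfaction and strong equivalence in terms of pairs of sets of atoms -/

/-- Satisfaction of an infinitary formula by the here-and-there interpretation `⟨Y, X⟩`. -/
def Inf.HTSat {A : Type} (X Y : Set A) : Inf A → Prop
  | .atom a => a ∈ Y ∧ a ∈ X
  | .conj f => ∀ i, (f i).HTSat X Y
  | .disj f => ∃ i, (f i).HTSat X Y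
  | .imp F G => (F.HTSat X Y → G.HTSat X Y) ∧ (F.Sat X → G.Sat X)

variable {A : Type} {X Y : Set A}

/-- Persistence needs no `Y ⊆ X`: the atom clause of `HTSat` already asks for membership in both
sets, and the implication clause contains the classical condition. -/
theorem Inf.HTSat.sat {F : Inf A} (h : F.HTSat X Y) : F.Sat X := by
  induction F with
  | atom a => exact h.2
  | conj f ih => exact fun i => ih i (h i)
  | disj f ih => exact h.imp fun i hi => ih i hi
  | imp F G _ _ => exact h.2

@[simp] theorem Inf.sat_bot : ¬ (Inf.bot : Inf A).Sat X := fun h => h.elim fun i _ => i.elim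

@[simp] theorem Inf.sat_top : (Inf.top : Inf A).Sat X := fun i => i.elim

@[simp] theorem Inf.htSat_bot : ¬ (Inf.bot : Inf A).HTSat X Y := fun h => h.elim fun i _ => i.elim

@[simp] theorem Inf.htSat_top : (Inf.top : Inf A).HTSat X Y := fun i => i.elim

@[simp] theorem Inf.sat_neg {F : Inf A} : F.neg.Sat X ↔ ¬ F.Sat X :=
  ⟨fun h hF => sat_bot (h hF), fun h hF => (h hF).elim⟩

@[simp] theorem Inf.htSat_neg {F : Inf A} : F.neg.HTSat X Y ↔ ¬ F.Sat X :=
  ⟨fun h hF => sat_bot (h.2 hF), fun h => ⟨fun hF => (h hF.sat).elim, fun hF => (h hF).elim⟩⟩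

@[simp] theorem Inf.sat_conjList {L : List (Inf A)} :
    (Inf.conjList L).Sat X ↔ ∀ F ∈ L, F.Sat X := by
  rw [List.forall_mem_iff_get]
  rfl

@[simp] theorem Inf.htSat_conjList {L : List (Inf A)} :
    (Inf.conjList L).HTSat X Y ↔ ∀ F ∈ L, F.HTSat X Y := by
  rw [List.forall_mem_iff_get]
  rfl

/-- The reduct turns an implication that `X` violates into `⊥`; the classical conjunct of the
implication clause of `HTSat` performs the same test. For an atom, the test is membership in `X`. -/
theorem Inf.sat_ftReduct {F : Inf A} : (F.ftReduct X).Sat Y ↔ F.HTSat X Y := by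
  induction F with
  | atom a =>
    by_cases h : a ∈ X
    · simp [ftReduct, HTSat, Sat, h]
    · simp [ftReduct, HTSat, h]
  | conj f ih => exact forall_congr' ih
  | disj f ih => exact exists_congr ih
  | imp F G ihF ihG =>
    by_cases h : (Inf.imp F G).Sat X
    · have h' : F.Sat X → G.Sat X := h
      simp only [ftReduct, if_pos h, HTSat, and_iff_left h']
      exact imp_congr ihF ihG
    · have h' : ¬ (F.Sat X → G.Sat X) := h
      simp [ftReduct, if_neg h, HTSat, h']

theorem Inf.htSat_self {F : Inf A} : F.HTSat X X ↔ F.Sat X := by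
  induction F with
  | atom a => exact and_self_iff
  | conj f ih => exact forall_congr' ih
  | disj f ih => exact exists_congr ih
  | imp F G ihF ihG =>
    simp only [HTSat, Sat, ihF, ihG, and_self]

/-! ### Strong equivalence as agreement on pairs of sets of atoms. -/

section StrongEquivalence

/-- A ground atom as an atom. -/
def GAtom.toAtom {C : Type} (V : Type) (a : GAtom C) : Atom C V := ⟨a.1, a.2.map .ground⟩

@[simp] theorem GAtom.inst_toAtom {C V : Type} (a : GAtom C) (z : V → Ground C) :
    (GAtom.toAtom V a).inst z = a := by
  simp [GAtom.toAtom, Atom.inst, Function.comp_def, PTerm.inst]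

variable {C V : Type} [LinearOrder C] [DecidableEq V]

/-- `Y` is a model of the reduct of `Pg` with respect to `X`. -/
def ReductSat (s : Sem) (Pg : Program C V) (X Y : Set (GAtom C)) : Prop :=
  match s with
  | .cli => ((Program.tau Pg).ftReduct X).Sat Y
  | .dlv => ((Program.tau Pg).flpReduct X).Sat Y

/-- The reduct with respect to `X` is satisfied both by `X` and by `Y`. -/
def PairSat (s : Sem) (Pg : Program C V) (X Y : Set (GAtom C)) : Prop :=
  ReductSat s Pg X X ∧ ReductSat s Pg X Y

/-- The condition that the reduct with respect to `X` of a single rule imposes on `Y`. -/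
def Rule.ReductSat (s : Sem) (R : Rule C V) (X Y : Set (GAtom C)) : Prop :=
  match s with
  | .cli => ∀ z : V → Ground C,
      ((∀ l ∈ R.body, (l.tau R.globals z).HTSat X Y) → (headTau z R.head).HTSat X Y) ∧
      ((∀ l ∈ R.body, (l.tau R.globals z).Sat X) → (headTau z R.head).Sat X)
  | .dlv => ∀ z : V → Ground C, (∀ l ∈ R.body, (l.tau R.globals z).Sat X) →
      (∀ l ∈ R.body, (l.tau R.globals z).Sat Y) → (headTau z R.head).Sat Y

/-- A program is a conjunction of conjunctions of rule instances. The FLP reduct therefore acts on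
whole rule instances and never reaches the implications inside aggregates, whereas the clingo reduct
descends into them. -/
theorem reductSat_iff {s : Sem} {Pg : Program C V} {X Y : Set (GAtom C)} :
    ReductSat s Pg X Y ↔ ∀ R ∈ Pg, R.ReductSat s X Y := by
  cases s with
  | cli =>
    simp only [ReductSat, Inf.sat_ftReduct, Program.tau, Rule.tau, Inf.HTSat, Subtype.forall,
      Inf.htSat_conjList, Inf.sat_conjList, List.forall_mem_map, Rule.ReductSat]
  | dlv =>
    simp only [ReductSat, Program.tau, Rule.tau, Inf.flpReduct, Inf.Sat, Subtype.forall,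
      Rule.ReductSat]
    refine forall₃_congr fun R _ z => ?_
    by_cases h : ∀ l ∈ R.body, (l.tau R.globals z).Sat X
    · rw [if_pos (by simpa using h)]
      simp only [Inf.Sat, Inf.sat_conjList, List.forall_mem_map]
      exact ⟨fun g _ => g, fun g => g h⟩
    · rw [if_neg (by simpa using h)]
      simp [h]

theorem reductSat_union {s : Sem} {Pg Δ : Program C V} {X Y : Set (GAtom C)} :
    ReductSat s (Pg ∪ Δ) X Y ↔ ReductSat s Pg X Y ∧ ReductSat s Δ X Y := by
  simp only [reductSat_iff, Set.mem_union, or_imp, forall_and]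

theorem isAnswerSet_iff {s : Sem} {Pg : Program C V} {X : Set (GAtom C)} :
    IsAnswerSet Pg X s ↔ ReductSat s Pg X X ∧ ∀ Y, Y ⊂ X → ¬ ReductSat s Pg X Y := by
  cases s <;> rfl

/-- The fact `a`. -/
def factRule (V : Type) (a : GAtom C) : Rule C V := ⟨some (GAtom.toAtom V a), []⟩

/-- The rule `b ← a`. -/
def implRule (V : Type) (a b : GAtom C) : Rule C V :=
  ⟨some (GAtom.toAtom V b), [.basic ⟨.pos, .atom (GAtom.toAtom V a)⟩]⟩

theorem reductSat_factRule {s : Sem} {a : GAtom C} {X Y : Set (GAtom C)} (ha : a ∈ X) :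
    (factRule V a).ReductSat s X Y ↔ a ∈ Y := by
  -- A fact has no variables, but its instances are still indexed by substitutions, so one must
  -- exist for the condition to have content.
  have : Nonempty (V → Ground C) := ⟨fun _ => .inf⟩
  cases s <;> simp [Rule.ReductSat, factRule, headTau, Inf.HTSat, Inf.Sat, ha]

theorem reductSat_implRule {s : Sem} {a b : GAtom C} {X Y : Set (GAtom C)} (ha : a ∈ X)
    (hb : b ∈ X) : (implRule V a b).ReductSat s X Y ↔ (a ∈ Y → b ∈ Y) := by
  have : Nonempty (V → Ground C) := ⟨fun _ => .inf⟩
  cases s <;> simp [Rule.ReductSat, implRule, headTau, Literal.tau, BasicLit.tau, Sign.applyInf,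
    AtomicFormula.tau, Inf.HTSat, Inf.Sat, ha, hb]

/-- If the pair satisfied only the first program, some context would make `X` an answer set of one
extended program and not of the other. One context handles failure at `X`, another failure at `Y`.
-/
theorem StronglyEquivalent.pairSat {s : Sem} {Pg₁ Pg₂ : Program C V}
    (h : StronglyEquivalent s Pg₁ Pg₂) {X Y : Set (GAtom C)} (hYX : Y ⊆ X)
    (h₁ : PairSat s Pg₁ X Y) : PairSat s Pg₂ X Y := by
  have hX : ReductSat s Pg₂ X X := by
    -- With all of `X` added as facts, no proper subset of `X` is a model, so `X` is an answer set
    -- as soon as it is a model.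
    have facts : ∀ Z, ReductSat s (factRule V '' X) X Z ↔ X ⊆ Z := fun Z => by
      rw [reductSat_iff, Set.forall_mem_image]
      exact forall₂_congr fun a ha => reductSat_factRule ha
    have := (h (factRule V '' X) X).1 <| isAnswerSet_iff.2
      ⟨reductSat_union.2 ⟨h₁.1, (facts X).2 subset_rfl⟩,
        fun Z hZ hr => hZ.2 ((facts Z).1 (reductSat_union.1 hr).2)⟩
    exact (reductSat_union.1 (isAnswerSet_iff.1 this).1).1
  refine ⟨hX, by_contra fun hY => ?_⟩
  have hne : Y ≠ X := fun e => hY (e ▸ hX)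
  -- Between `Y` and `X`, the only models of this context are `Y` and `X` themselves: one atom of `X
  -- \ Y` forces all the others. So `Y` is the sole candidate for refuting the minimality of `X`.
  let Δ : Program C V := factRule V '' Y ∪
    {R | ∃ a ∈ X \ Y, ∃ b ∈ X \ Y, R = implRule V a b}
  have hΔ : ∀ Z, ReductSat s Δ X Z ↔
      Y ⊆ Z ∧ ∀ a ∈ X \ Y, ∀ b ∈ X \ Y, a ∈ Z → b ∈ Z := fun Z => by
    rw [reductSat_union, reductSat_iff, reductSat_iff, Set.forall_mem_image]
    refine and_congr (forall₂_congr fun a ha => reductSat_factRule (hYX ha)) ?_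
    constructor
    · exact fun hR a ha b hb => (reductSat_implRule ha.1 hb.1).1 (hR _ ⟨a, ha, b, hb, rfl⟩)
    · rintro hR _ ⟨a, ha, b, hb, rfl⟩
      exact (reductSat_implRule ha.1 hb.1).2 (hR a ha b hb)
  have h₂ : IsAnswerSet (Pg₂ ∪ Δ) X s := by
    refine isAnswerSet_iff.2 ⟨reductSat_union.2 ⟨hX, (hΔ X).2 ⟨hYX, fun _ _ _ hb _ => hb.1⟩⟩,
      fun Z hZ hr => ?_⟩
    obtain ⟨hr₁, hr₂⟩ := reductSat_union.1 hr
    obtain ⟨hYZ, hZ'⟩ := (hΔ Z).1 hr₂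
    by_cases hZY : Z ⊆ Y
    · exact hY (subset_antisymm hZY hYZ ▸ hr₁)
    · obtain ⟨a, haZ, haY⟩ := Set.not_subset.1 hZY
      refine hZ.2 fun b hb => ?_
      by_cases hbY : b ∈ Y
      · exact hYZ hbY
      · exact hZ' a ⟨hZ.1 haZ, haY⟩ b ⟨hb, hbY⟩ haZ
  refine (isAnswerSet_iff.1 ((h Δ X).2 h₂)).2 Y (hYX.ssubset_of_ne hne) ?_
  exact reductSat_union.2 ⟨h₁.2, (hΔ Y).2 ⟨subset_rfl, fun a ha _ _ haY => (ha.2 haY).elim⟩⟩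

/-- For the converse, the pair `X`, `X` compares the two programs at `X`. Once `X` is known to be a
model, the condition on `X`, `Y` reduces to the one on `Y`, which is what minimality inspects. -/
theorem stronglyEquivalent_iff {s : Sem} {Pg₁ Pg₂ : Program C V} :
    StronglyEquivalent s Pg₁ Pg₂ ↔
      ∀ X Y : Set (GAtom C), Y ⊆ X → (PairSat s Pg₁ X Y ↔ PairSat s Pg₂ X Y) := by
  refine ⟨fun h X Y hYX => ⟨h.pairSat hYX, StronglyEquivalent.pairSat
    (fun Δ X => (h Δ X).symm) hYX⟩, fun h Δ X => ?_⟩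
  have hX : ReductSat s Pg₁ X X ↔ ReductSat s Pg₂ X X := by
    simpa [PairSat] using h X X subset_rfl
  simp only [isAnswerSet_iff, reductSat_union, hX]
  refine and_congr_right fun h₂ => forall₂_congr fun Y hY => ?_
  have := h X Y hY.1
  simp only [PairSat, hX, h₂.1, true_and] at this
  rw [this]

end StrongEquivalence

end Infinitary

section Closed

/-! ## Free variables -/

variable {C V : Type} {σ : Sig C V} {M : Type}

/-- All free variables of `F` are of the general sort and belong to `W`. -/
def Formula.GenFreeIn (W : Set V) (F : Formula σ M) : Prop :=
  ∀ v : SVar V, F.Free v → ∃ x ∈ W, v = ⟨.gen, x⟩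

theorem Term.occurs_mark {M' : Type} {m : M'} {v : SVar V} {s : Srt} {t : Term σ M s} :
    (t.mark m).Occurs v ↔ t.Occurs v := by
  induction t with
  | var x => rfl
  | const g => rfl
  | tuple k hk ts ih => exact exists_congr ih
  | agg op t ih => exact ih
  | setFn m x e he ts ih => exact exists_congr ih

namespace Formula

theorem free_mark {M' : Type} {m : M'} {v : SVar V} {F : Formula σ M} :
    (F.mark m).Free v ↔ F.Free v := by
  induction F with
  | bot => rfl
  | atom _ p hp ts => exact exists_congr fun i => Term.occurs_mark
  | eq t u => exact or_congr Term.occurs_mark Term.occurs_mark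
  | cmp c hc t u => exact or_congr Term.occurs_mark Term.occurs_mark
  | mem t u => exact or_congr Term.occurs_mark Term.occurs_mark
  | sneg F ih => exact ih
  | and F G ihF ihG => exact or_congr ihF ihG
  | or F G ihF ihG => exact or_congr ihF ihG
  | imp F G ihF ihG => exact or_congr ihF ihG
  | all x F ih => exact and_congr_left' ih
  | ex x F ih => exact and_congr_left' ih

theorem free_neg {v : SVar V} {F : Formula σ M} : F.neg.Free v ↔ F.Free v :=
  or_iff_left id

theorem free_N {v : SVar V} {F : Formula σ M} : F.N.Free v ↔ F.Free v := by
  induction F with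
  | bot => rfl
  | atom _ p hp ts => rfl
  | eq t u => rfl
  | cmp c hc t u => rfl
  | mem t u => rfl
  | sneg F ih => exact free_neg.trans ih
  | and F G ihF ihG => exact or_congr ihF ihG
  | or F G ihF ihG => exact or_congr ihF ihG
  | imp F G ihF ihG => exact or_congr ihF ihG
  | all x F ih => exact and_congr_left' ih
  | ex x F ih => exact and_congr_left' ih

/-- `γ` matches `F → ⊥` as a negation, so its general clause for implications unfolds only once this
case is excluded. -/
theorem gamma_imp {F G : Formula σ Unit} (hG : G ≠ .bot) :
    (Formula.imp F G).gamma = .and (.imp F.gamma G.gamma) (.imp F.hat G.hat) := by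
  cases G <;> first | exact absurd rfl hG | rfl

theorem free_gamma {v : SVar V} {F : Formula σ Unit} : F.gamma.Free v → F.Free v := by
  induction F with
  | bot => exact id
  | atom _ p hp ts => exact fun h => h.elim free_mark.1 free_mark.1
  | eq t u => exact fun h => h.elim free_mark.1 free_mark.1
  | cmp c hc t u => exact fun h => h.elim free_mark.1 free_mark.1
  | mem t u => exact fun h => h.elim free_mark.1 free_mark.1
  | sneg F ih =>
    exact fun h => h.elim (fun h => free_mark.1 (free_neg.1 h))
      fun h => (free_N (F := F)).1 ((free_mark (F := F.N)).1 (free_neg.1 h))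
  | and F G ihF ihG => exact Or.imp ihF ihG
  | or F G ihF ihG => exact Or.imp ihF ihG
  | imp F G ihF ihG =>
    by_cases hG : G = .bot
    · subst hG
      exact fun h => .inl (free_mark.1 (free_neg.1 h))
    · rw [gamma_imp hG]
      exact fun h => h.elim (Or.imp ihF ihG) (Or.imp free_mark.1 free_mark.1)
  | all x F ih => exact And.imp_left ih
  | ex x F ih => exact And.imp_left ih

theorem free_conj {v : SVar V} {L : List (Formula σ M)} :
    (conj L).Free v → ∃ F ∈ L, F.Free v := by
  induction L with
  | nil => exact fun h => (h.elim id id : False).elim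
  | cons F L ih =>
    cases L with
    | nil => exact fun h => ⟨F, by simp, h⟩
    | cons G L =>
      rintro (h | h)
      · exact ⟨F, by simp, h⟩
      · obtain ⟨F', hF', h'⟩ := ih h
        exact ⟨F', List.mem_cons_of_mem _ hF', h'⟩

theorem free_allGen {v : SVar V} {X : List V} {F : Formula σ M} :
    (allGen X F).Free v ↔ F.Free v ∧ ∀ x ∈ X, v ≠ ⟨.gen, x⟩ := by
  induction X with
  | nil => simp [allGen]
  | cons x X ih =>
    change (allGen X F).Free v ∧ v ≠ ⟨.gen, x⟩ ↔ _
    rw [ih, List.forall_mem_cons, and_assoc, and_comm (a := v ≠ _)]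

theorem free_exGen {v : SVar V} {X : List V} {F : Formula σ M} :
    (exGen X F).Free v ↔ F.Free v ∧ ∀ x ∈ X, v ≠ ⟨.gen, x⟩ := by
  induction X with
  | nil => simp [exGen]
  | cons x X ih =>
    change (exGen X F).Free v ∧ v ≠ ⟨.gen, x⟩ ↔ _
    rw [ih, List.forall_mem_cons, and_assoc, and_comm (a := v ≠ _)]

theorem not_free_conj {v : SVar V} {L : List (Formula σ M)} (h : ∀ F ∈ L, ¬ F.Free v) :
    ¬ (conj L).Free v := fun hv => by
  obtain ⟨F, hF, hFv⟩ := free_conj hv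
  exact h F hF hFv

theorem not_free_allGen {X : List V} {F : Formula σ M} (h : F.GenFreeIn {x | x ∈ X})
    (v : SVar V) : ¬ (allGen X F).Free v := fun hv => by
  obtain ⟨hF, hX⟩ := free_allGen.1 hv
  obtain ⟨x, hx, rfl⟩ := h v hF
  exact hX x hx rfl

theorem free_cmpFormula {v : SVar V} {c : Cmp} {t u : Term σ M .gen}
    (h : (cmpFormula c t u).Free v) : t.Occurs v ∨ u.Occurs v := by
  unfold cmpFormula at h
  split_ifs at h <;> exact h

end Formula

open Formula

theorem PTerm.occurs_toTerm {v : SVar V} {t : PTerm C V} (h : (t.toTerm σ M).Occurs v) :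
    ∃ x ∈ t.vars, v = ⟨.gen, x⟩ := by
  cases t with
  | ground g => exact h.elim
  | var x => exact ⟨x, by simp [PTerm.vars], h⟩

theorem Atom.free_toFormula {v : SVar V} {A : Atom C V} {h : A.sym ∈ σ.P}
    (hv : (A.toFormula σ h).Free v) : ∃ x ∈ A.args.flatMap PTerm.vars, v = ⟨.gen, x⟩ := by
  obtain ⟨i, hi⟩ := hv
  obtain ⟨x, hx, rfl⟩ := PTerm.occurs_toTerm hi
  exact ⟨x, List.mem_flatMap.2 ⟨_, List.get_mem _ _, hx⟩, rfl⟩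

theorem AtomicFormula.free_toFormula {v : SVar V} {A : AtomicFormula C V}
    {h : ∀ p ∈ A.preds, p ∈ σ.P} (hv : (A.toFormula σ h).Free v) :
    ∃ x ∈ A.vars, v = ⟨.gen, x⟩ := by
  cases A with
  | atom A => exact Atom.free_toFormula hv
  | cmp c t u =>
    rcases free_cmpFormula hv with h | h <;> obtain ⟨x, hx, rfl⟩ := PTerm.occurs_toTerm h
    · exact ⟨x, List.mem_append_left _ hx, rfl⟩
    · exact ⟨x, List.mem_append_right _ hx, rfl⟩

theorem Sem.free_neg {v : SVar V} {x : Sem} {F : Formula σ M} :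
    (x.neg σ F).Free v ↔ F.Free v := by
  cases x
  · exact Formula.free_neg
  · rfl

theorem Sign.free_apply {v : SVar V} {x : Sem} {s : Sign} {F : Formula σ M} :
    (s.apply σ x F).Free v ↔ F.Free v := by
  cases s
  · rfl
  · exact Sem.free_neg
  · exact Sem.free_neg.trans Sem.free_neg

theorem BasicLit.free_toFormula {v : SVar V} {x : Sem} {l : BasicLit C V}
    {h : ∀ p ∈ l.form.preds, p ∈ σ.P} (hv : (l.toFormula σ x h).Free v) :
    ∃ x ∈ l.form.vars, v = ⟨.gen, x⟩ :=
  AtomicFormula.free_toFormula (Sign.free_apply.1 hv)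

theorem SetSym.occurs_toTerm {v : SVar V} {m : M} {x : Sem} {e : SetSym C V} {he : e ∈ σ.S}
    (hv : (e.toTerm σ m x he).Occurs v) : ∃ x ∈ e.vars, v = ⟨.gen, x⟩ := by
  obtain ⟨i, hi⟩ := hv
  exact ⟨_, List.get_mem _ _, hi⟩

theorem not_free_HT [Infinite V] {F : Formula σ Mark} (hF : F ∈ HT σ) (v : SVar V) :
    ¬ F.Free v := by
  obtain ⟨p, -, rfl⟩ := List.mem_map.1 hF
  refine not_free_allGen (fun v hv => ?_) v
  have : ∃ i : Fin p.1.2, v = ⟨.gen, Infinite.natEmbedding V i⟩ := hv.elim id id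
  obtain ⟨i, rfl⟩ := this
  exact ⟨_, by simp [firstVars], rfl⟩

variable [LinearOrder V]

theorem Literal.free_toFormula {v : SVar V} {x : Sem} {Z : Finset V} {l : Literal C V}
    {hP : ∀ p ∈ l.preds, p ∈ σ.P} {hS : ∀ e ∈ l.setSyms Z, e ∈ σ.S}
    (hZ : ∀ x ∈ l.globals, x ∈ Z) (hv : (l.toFormula σ x Z hP hS).Free v) :
    ∃ x ∈ Z, v = ⟨.gen, x⟩ := by
  cases l with
  | basic l =>
    obtain ⟨x, hx, rfl⟩ := BasicLit.free_toFormula hv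
    exact ⟨x, hZ x hx, rfl⟩
  | agg s A =>
    rcases free_cmpFormula (Sign.free_apply.1 hv) with h | h
    · obtain ⟨x, hx, rfl⟩ := SetSym.occurs_toTerm h
      simp only [AggElem.setSym, Finset.mem_sort, Finset.mem_inter] at hx
      exact ⟨x, hx.2, rfl⟩
    · obtain ⟨x, hx, rfl⟩ := PTerm.occurs_toTerm h
      exact ⟨x, hZ x hx, rfl⟩

theorem Rule.not_free_toFormula {x : Sem} {R : Rule C V} {h : R.Over σ} (v : SVar V) :
    ¬ (R.toFormula σ x h).Free v := by
  refine not_free_allGen (fun v hv => ?_) v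
  simp only [Finset.mem_sort, Set.mem_ofPred_eq]
  rcases hv with hv | hv
  · obtain ⟨F, hF, hv⟩ := free_conj hv
    obtain ⟨l, -, rfl⟩ := List.mem_map.1 hF
    refine Literal.free_toFormula (fun x hx => ?_) hv
    simp only [Rule.globals, List.mem_toFinset]
    exact List.mem_append_right _ (List.mem_flatMap.2 ⟨_, l.2, hx⟩)
  · obtain ⟨head, body⟩ := R
    cases head with
    | none => exact hv.elim
    | some A =>
      obtain ⟨x, hx, rfl⟩ := Atom.free_toFormula hv
      refine ⟨x, ?_, rfl⟩
      simp only [Rule.globals, List.mem_toFinset]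
      exact List.mem_append_left _ (by simpa using hx)

theorem not_free_gammaTau {x : Sem} {Pg : Finset (Rule C V)} {h : ∀ R ∈ Pg, R.Over σ}
    (v : SVar V) : ¬ (gammaTau σ x Pg h).Free v := by
  refine not_free_conj fun F hF hv => ?_
  obtain ⟨G, hG, rfl⟩ := List.mem_map.1 hF
  obtain ⟨R, -, rfl⟩ := List.mem_map.1 hG
  exact Rule.not_free_toFormula v (free_gamma hv)

theorem free_elemFormula {x : Sem} {e : SetSym C V} {he : e ∈ σ.S} {v : SVar V}
    (hv : (elemFormula x e he).Free v) :
    (∃ x ∈ e.elem.vars, v = ⟨.gen, x⟩) ∨ v = ⟨.tuple, (0 : ℕ)⟩ := by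
  simp only [AggElem.vars, List.mem_toFinset]
  obtain ⟨F, hF, hv⟩ := free_conj hv
  rcases List.mem_cons.1 hF with rfl | hF
  · rcases hv with hv | ⟨i, hv⟩
    · exact .inr hv
    · obtain ⟨x, hx, rfl⟩ := PTerm.occurs_toTerm hv
      exact .inl ⟨x, List.mem_append_left _ (List.mem_flatMap.2 ⟨_, List.get_mem _ _, hx⟩), rfl⟩
  · obtain ⟨l, -, rfl⟩ := List.mem_map.1 hF
    obtain ⟨x, hx, rfl⟩ := BasicLit.free_toFormula hv
    exact .inl ⟨x, List.mem_append_right _ (List.mem_flatMap.2 ⟨_, l.2, hx⟩), rfl⟩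

theorem not_free_aggSentence {m : Mark} {x : Sem} {e : SetSym C V} {he : e ∈ σ.S}
    {G : Formula σ Mark}
    (hG : ∀ v, G.Free v → (∃ x ∈ e.elem.vars, v = ⟨.gen, x⟩) ∨ v = ⟨.tuple, (0 : ℕ)⟩)
    (v : SVar V) : ¬ (aggSentence m x e he G).Free v := by
  refine not_free_allGen (fun v hv => ?_) v
  obtain ⟨hv, hT⟩ := hv
  have hmem : (Formula.mem varT (e.toTerm σ m x he)).Free v → ∃ x ∈ e.vars, v = ⟨.gen, x⟩ :=
    fun h => h.elim (fun h => (hT h).elim) SetSym.occurs_toTerm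
  have hex : (exGen e.locals G).Free v → ∃ x ∈ e.vars, v = ⟨.gen, x⟩ := fun h => by
    obtain ⟨h, hloc⟩ := free_exGen.1 h
    obtain ⟨x, hx, rfl⟩ := (hG v h).resolve_right hT
    refine ⟨x, by_contra fun hxe => hloc x ?_ rfl, rfl⟩
    simpa [SetSym.locals, hx] using hxe
  exact hv.elim (fun h => h.elim hmem hex) fun h => h.elim hex hmem

theorem not_free_AGG {F : Formula σ Mark} (hF : F ∈ AGG σ) (v : SVar V) : ¬ F.Free v := by
  obtain ⟨e, -, hF⟩ := List.mem_flatMap.1 hF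
  simp only [List.mem_cons, List.not_mem_nil, or_false] at hF
  rcases hF with rfl | rfl | rfl | rfl
  · exact not_free_aggSentence (fun v hv => free_elemFormula (free_mark.1 hv)) v
  · exact not_free_aggSentence (fun v hv => free_elemFormula (free_mark.1 hv)) v
  · exact not_free_aggSentence (fun v hv => free_elemFormula (free_gamma hv)) v
  · exact not_free_aggSentence (fun v hv => free_elemFormula (free_N.1 (free_mark.1 hv))) v

end Closed

/-! ### How the translations commute with conjunctions, quantifiers, comparisons and signs. -/

section SyntacticIdentities

variable {C V : Type} {σ : Sig C V}

/-- Assignments `z` and `z'` coincide outside `X`. -/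
def EqOff (X : List V) (z z' : V → Ground C) : Prop := ∀ x, x ∉ X → z' x = z x

theorem eqOff_cons [DecidableEq V] {x : V} {X : List V} {z z' : V → Ground C} :
    EqOff (x :: X) z z' ↔ ∃ d, EqOff X (Function.update z x d) z' := by
  constructor
  · intro h
    -- If `x` occurs again in `X`, the value chosen here is overridden later, so no absence of
    -- repetitions is needed.
    refine ⟨z' x, fun y hy => ?_⟩
    by_cases hyx : y = x
    · simp [hyx]
    · rw [Function.update_of_ne hyx]
      exact h y (by simp [hyx, hy])
  · rintro ⟨d, h⟩ y hy
    rw [List.mem_cons, not_or] at hy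
    rw [h y hy.2, Function.update_of_ne hy.1]

open Formula

theorem Formula.mark_conj {M M' : Type} {m : M'} {L : List (Formula σ M)} :
    (conj L).mark m = conj (L.map (mark m)) := by
  induction L with
  | nil => rfl
  | cons F L ih =>
    cases L with
    | nil => rfl
    | cons G L => exact congrArg (Formula.and (F.mark m)) ih

theorem Formula.N_conj {M : Type} {L : List (Formula σ M)} : (conj L).N = conj (L.map N) := by
  induction L with
  | nil => rfl
  | cons F L ih =>
    cases L with
    | nil => rfl
    | cons G L => exact congrArg (Formula.and F.N) ih

theorem Formula.gamma_conj {L : List (Formula σ Unit)} :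
    (conj L).gamma = conj (L.map gamma) := by
  induction L with
  | nil => rfl
  | cons F L ih =>
    cases L with
    | nil => rfl
    | cons G L => exact congrArg (Formula.and F.gamma) ih

theorem Formula.gamma_allGen {X : List V} {F : Formula σ Unit} :
    (allGen X F).gamma = allGen X F.gamma := by
  induction X with
  | nil => rfl
  | cons x X ih => exact congrArg (Formula.all (s := .gen) x) ih

theorem gamma_cmpFormula {c : Cmp} {t u : Term σ Unit .gen} :
    (cmpFormula c t u).gamma = .and (cmpFormula c t u).plain (cmpFormula c t u).hat := by
  unfold cmpFormula
  split_ifs <;> rfl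

theorem N_cmpFormula {M : Type} {c : Cmp} {t u : Term σ M .gen} :
    (cmpFormula c t u).N = cmpFormula c t u := by
  unfold cmpFormula
  split_ifs <;> rfl

theorem AtomicFormula.N_toFormula {A : AtomicFormula C V} {h : ∀ p ∈ A.preds, p ∈ σ.P} :
    (A.toFormula σ h).N = A.toFormula σ h := by
  cases A with
  | atom A => rfl
  | cmp c t u => exact N_cmpFormula

theorem AtomicFormula.gamma_toFormula {A : AtomicFormula C V} {h : ∀ p ∈ A.preds, p ∈ σ.P} :
    (A.toFormula σ h).gamma = .and (A.toFormula σ h).plain (A.toFormula σ h).hat := by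
  cases A with
  | atom A => rfl
  | cmp c t u => exact gamma_cmpFormula

theorem Sign.N_apply_dlv {M : Type} {s : Sign} {F : Formula σ M} :
    (s.apply σ .dlv F).N = s.apply σ .cli F.N := by
  cases s <;> rfl

/-- The two translations of a basic literal differ only in the negation used for `not`. This makes
the plain dlv axiom of `AGG` classical satisfaction in `Y`. -/
theorem BasicLit.N_toFormula_dlv {l : BasicLit C V} {h : ∀ p ∈ l.form.preds, p ∈ σ.P} :
    (l.toFormula σ .dlv h).N = l.toFormula σ .cli h := by
  rw [toFormula, Sign.N_apply_dlv, AtomicFormula.N_toFormula]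
  rfl

end SyntacticIdentities

section Denotes

/-! ## Meaning of formulas in a standard interpretation -/

variable {C V : Type} [LinearOrder C] {σ : Sig C V} {J : StandardInterp σ Mark}

/-- The assignment `ρ` gives every variable `x` of the general sort in its domain the value `z x`,
and gives `T` the value `t` if `T` is in its domain. -/
structure Agrees (J : StandardInterp σ Mark) {Q : SVar V → Prop}
    (ρ : (v : SVar V) → Q v → J.toInterp.carrier v.1) (z : V → Ground C)
    (t : List (Ground C)) : Prop where
  gen : ∀ x (h : Q ⟨.gen, x⟩), ρ ⟨.gen, x⟩ h = z x
  tuple : ∀ h : Q ⟨.tuple, (0 : ℕ)⟩, (ρ ⟨.tuple, (0 : ℕ)⟩ h).1 = t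

variable (J) in
/-- The truth value of `F` in `J` depends on the values `z` of the variables of the general sort
and on the value `t` of `T` as described by `P`. -/
def Denotes (F : Formula σ Mark) (P : (V → Ground C) → List (Ground C) → Prop) : Prop :=
  ∀ ρ z t, Agrees J ρ z t → (F.Sat J.toInterp ρ ↔ P z t)

theorem Agrees.restrict {Q Q' : SVar V → Prop}
    {ρ : (v : SVar V) → Q v → J.toInterp.carrier v.1} {z : V → Ground C} {t : List (Ground C)}
    (h : Agrees J ρ z t) (f : ∀ v, Q' v → Q v) : Agrees J (fun v hv => ρ v (f v hv)) z t :=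
  ⟨fun x hx => h.gen x (f _ hx), fun ht => h.tuple (f _ ht)⟩

theorem Agrees.update_gen [DecidableEq V] {Q : SVar V → Prop} {x : V}
    {ρ : (v : SVar V) → Q v ∧ v ≠ ⟨.gen, x⟩ → J.toInterp.carrier v.1} {z : V → Ground C}
    {t : List (Ground C)} (h : Agrees J ρ z t) (d : Ground C) :
    Agrees J (updateAssignment (D := J.toInterp.carrier) (s := .gen) x d ρ)
      (Function.update z x d) t := by
  constructor
  · intro y hy
    by_cases hxy : y = x
    · subst hxy
      simp only [updateAssignment, dif_pos, Function.update_self]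
      rfl
    · have : (⟨.gen, y⟩ : SVar V) ≠ ⟨.gen, x⟩ := by simpa using hxy
      simp only [updateAssignment, dif_neg this, Function.update_of_ne hxy]
      exact h.gen y ⟨hy, this⟩
  · intro hT
    have : (⟨.tuple, (0 : ℕ)⟩ : SVar V) ≠ ⟨.gen, x⟩ := by simp
    simp only [updateAssignment, dif_neg this]
    exact h.tuple ⟨hT, this⟩

theorem Agrees.update_tuple {Q : SVar V → Prop}
    {ρ : (v : SVar V) → Q v ∧ v ≠ ⟨.tuple, (0 : ℕ)⟩ → J.toInterp.carrier v.1} {z : V → Ground C}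
    {t : List (Ground C)} (h : Agrees J ρ z t) (d : {t // t ∈ σ.tupleUniverse}) :
    Agrees J (updateAssignment (D := J.toInterp.carrier) (s := .tuple) (0 : ℕ) d ρ) z d.1 := by
  constructor
  · intro y hy
    have : (⟨.gen, y⟩ : SVar V) ≠ ⟨.tuple, (0 : ℕ)⟩ := by simp
    simp only [updateAssignment, dif_neg this]
    exact h.gen y ⟨hy, this⟩
  · intro hT
    simp only [updateAssignment, dif_pos]
    rfl

variable {F G : Formula σ Mark} {P Q : (V → Ground C) → List (Ground C) → Prop}

/-- A closed formula is true iff its meaning holds, whatever the values of the variables are. -/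
theorem Denotes.models_iff (h : Denotes J F P) (hF : ∀ v, ¬ F.Free v) (z : V → Ground C)
    (t : List (Ground C)) : J.toInterp.Models F ↔ P z t := by
  have agr : ∀ ρ, Agrees J (Q := F.Free) ρ z t := fun ρ =>
    ⟨fun x hx => (hF _ hx).elim, fun hx => (hF _ hx).elim⟩
  -- The assignment of a closed formula has empty domain. No element of a possibly empty universe is
  -- needed, and `t` may lie outside the tuple universe.
  exact ⟨fun hM => (h _ z t (agr fun v hv => (hF v hv).elim)).1 (hM _),
    fun hP ρ => (h ρ z t (agr ρ)).2 hP⟩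

theorem Denotes.congr {P' : (V → Ground C) → List (Ground C) → Prop} (h : Denotes J F P)
    (hP : ∀ z t, P z t ↔ P' z t) : Denotes J F P' :=
  fun ρ z t hρ => (h ρ z t hρ).trans (hP z t)

theorem denotes_bot : Denotes J .bot fun _ _ => False := fun _ _ _ _ => Iff.rfl

theorem Denotes.sneg (h : Denotes J F P) : Denotes J (.sneg F) fun z t => ¬ P z t :=
  fun _ _ _ hρ => not_congr (h _ _ _ (hρ.restrict _))

theorem Denotes.and (hF : Denotes J F P) (hG : Denotes J G Q) :
    Denotes J (.and F G) fun z t => P z t ∧ Q z t :=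
  fun _ _ _ hρ => and_congr (hF _ _ _ (hρ.restrict _)) (hG _ _ _ (hρ.restrict _))

theorem Denotes.imp (hF : Denotes J F P) (hG : Denotes J G Q) :
    Denotes J (.imp F G) fun z t => P z t → Q z t :=
  fun _ _ _ hρ => imp_congr (hF _ _ _ (hρ.restrict _)) (hG _ _ _ (hρ.restrict _))

theorem Denotes.neg (hF : Denotes J F P) : Denotes J F.neg fun z t => ¬ P z t :=
  hF.imp denotes_bot

theorem Denotes.iff (hF : Denotes J F P) (hG : Denotes J G Q) :
    Denotes J (.iff F G) fun z t => P z t ↔ Q z t :=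
  ((hF.imp hG).and (hG.imp hF)).congr fun _ _ => iff_def.symm

theorem Denotes.conj_cons {L : List (Formula σ Mark)} (hF : Denotes J F P)
    (hL : Denotes J (.conj L) Q) : Denotes J (.conj (F :: L)) fun z t => P z t ∧ Q z t := by
  cases L with
  | nil =>
    intro ρ z t hρ
    -- A one-element conjunction is the formula itself, so `Q` has to be discharged. It is the
    -- meaning of the empty conjunction `¬⊥`, which holds under the vacuous assignment.
    have : Q z t := (hL (fun v hv => (hv.elim id id : False).elim) z t
      ⟨fun _ hx => (hx.elim id id : False).elim, fun hx => (hx.elim id id : False).elim⟩).1 id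
    exact (hF ρ z t hρ).trans (and_iff_left this).symm
  | cons G L => exact hF.and hL

theorem denotes_conj_map {ι : Type*} (L : List ι) (f : ι → Formula σ Mark)
    (P : ι → (V → Ground C) → List (Ground C) → Prop) (h : ∀ i ∈ L, Denotes J (f i) (P i)) :
    Denotes J (.conj (L.map f)) fun z t => ∀ i ∈ L, P i z t := by
  induction L with
  | nil => exact denotes_bot.neg.congr (by simp)
  | cons i L ih =>
    refine ((h i List.mem_cons_self).conj_cons
      (ih fun j hj => h j (List.mem_cons_of_mem _ hj))).congr fun z t => ?_
    rw [List.forall_mem_cons]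

theorem Denotes.allGen (hF : Denotes J F P) (X : List V) :
    Denotes J (.allGen X F) fun z t => ∀ z', EqOff X z z' → P z' t := by
  classical
  induction X with
  | nil =>
    refine hF.congr fun z t => ⟨fun h z' hz => ?_, fun h => h z fun _ _ => rfl⟩
    rwa [funext fun x => hz x List.not_mem_nil]
  | cons x X ih =>
    intro ρ z t hρ
    simp only [eqOff_cons, forall_exists_index]
    rw [forall_comm]
    exact forall_congr' fun d => ih _ _ _ (hρ.update_gen d)

theorem Denotes.exGen (hF : Denotes J F P) (X : List V) :
    Denotes J (.exGen X F) fun z t => ∃ z', EqOff X z z' ∧ P z' t := by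
  classical
  induction X with
  | nil =>
    refine hF.congr fun z t => ⟨fun h => ⟨z, fun _ _ => rfl, h⟩, ?_⟩
    rintro ⟨z', hz, h⟩
    rwa [← funext fun x => hz x List.not_mem_nil]
  | cons x X ih =>
    intro ρ z t hρ
    simp only [eqOff_cons, ← exists_and_right]
    rw [exists_comm]
    exact exists_congr fun d => ih _ _ _ (hρ.update_gen d)

theorem Denotes.allTuple (hF : Denotes J F P) :
    Denotes J (.all (s := .tuple) (0 : ℕ) F) fun z _ => ∀ t ∈ σ.tupleUniverse, P z t := by
  intro ρ z t hρ
  refine Iff.trans (forall_congr' fun d => hF _ _ _ (hρ.update_tuple d)) ?_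
  exact Subtype.forall (p := (· ∈ σ.tupleUniverse)) (q := fun t => P z t.1)

end Denotes

section Literals

/-! ## Meaning of the translations of basic literals -/

variable {C V : Type} [LinearOrder C] {σ : Sig C V} {J : StandardInterp σ Mark}
  {At : Mark → Set (GAtom C)}

/-- The copies of the predicate symbols denote membership in the sets `At`. -/
def Describes (J : StandardInterp σ Mark) (At : Mark → Set (GAtom C)) : Prop :=
  ∀ m p hp ds, J.pred m p hp ds ↔ (p.1, List.ofFn ds) ∈ At m

theorem PTerm.eval_toTerm {m : Mark} {t : PTerm C V}
    {ρ : (v : SVar V) → ((t.toTerm σ Unit).mark m).Occurs v → J.toInterp.carrier v.1}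
    {z : V → Ground C} {T : List (Ground C)} (hρ : Agrees J ρ z T) :
    ((t.toTerm σ Unit).mark m).eval J.toInterp ρ = t.inst z := by
  cases t with
  | ground g => rfl
  | var x => exact hρ.gen x rfl

open Formula

/-- The values `a` and `b` are left abstract so that the lemma serves both comparisons of program
terms and comparisons of an aggregate term with its guard. -/
theorem denotes_cmpFormula {m : Mark} {c : Cmp} {t u : Term σ Unit .gen}
    {a b : (V → Ground C) → Ground C}
    (ha : ∀ (ρ : (v : SVar V) → (t.mark m).Occurs v → J.toInterp.carrier v.1) z T,
      Agrees J ρ z T → (t.mark m).eval J.toInterp ρ = a z)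
    (hb : ∀ (ρ : (v : SVar V) → (u.mark m).Occurs v → J.toInterp.carrier v.1) z T,
      Agrees J ρ z T → (u.mark m).eval J.toInterp ρ = b z) :
    Denotes J ((cmpFormula c t u).mark m) fun z _ => c.Holds (a z) (b z) := by
  by_cases hc : c = .eq
  · subst hc
    rw [show cmpFormula .eq t u = .eq t u from dif_pos rfl]
    exact fun ρ z T hρ => Iff.of_eq <|
      congrArg₂ (Cmp.Holds .eq) (ha _ z T (hρ.restrict _)) (hb _ z T (hρ.restrict _))
  · rw [show cmpFormula c t u = .cmp c hc t u from dif_neg hc]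
    exact fun ρ z T hρ => Iff.of_eq <|
      congrArg₂ (Cmp.Holds c) (ha _ z T (hρ.restrict _)) (hb _ z T (hρ.restrict _))

theorem Describes.atom (hJ : Describes J At) {m : Mark} {A : Atom C V} {h : A.sym ∈ σ.P} :
    Denotes J ((A.toFormula σ h).mark m) fun z _ => A.inst z ∈ At m := by
  intro ρ z t hρ
  refine (hJ m A.sym h _).trans ?_
  have : (List.ofFn fun i => (((A.args.get i).toTerm σ Unit).mark m).eval J.toInterp
      fun v hv => ρ v ⟨i, hv⟩) = A.args.map (PTerm.inst z) := by
    conv_rhs => rw [← List.ofFn_get A.args, List.map_ofFn]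
    exact congrArg List.ofFn (funext fun i => PTerm.eval_toTerm (hρ.restrict _))
  change _ ↔ (A.pred, A.args.map (PTerm.inst z)) ∈ At m
  rw [← this]
  rfl

/-- This is the semantic counterpart of `γA = A ∧ Â`. -/
theorem AtomicFormula.htSat_tau {A : AtomicFormula C V} {z : V → Ground C}
    {X Y : Set (GAtom C)} :
    (A.tau z).HTSat X Y ↔ (A.tau z).Sat Y ∧ (A.tau z).Sat X := by
  cases A with
  | atom A => rfl
  | cmp c t u => by_cases h : c.Holds (t.inst z) (u.inst z) <;> simp [tau, h]

theorem Describes.atomicFormula (hJ : Describes J At) {m : Mark} {A : AtomicFormula C V}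
    {h : ∀ p ∈ A.preds, p ∈ σ.P} :
    Denotes J ((A.toFormula σ h).mark m) fun z _ => (A.tau z).Sat (At m) := by
  cases A with
  | atom A => exact hJ.atom
  | cmp c t u =>
    refine (denotes_cmpFormula (fun _ _ _ => PTerm.eval_toTerm)
      fun _ _ _ => PTerm.eval_toTerm).congr fun z _ => ?_
    by_cases h : c.Holds (t.inst z) (u.inst z) <;> simp [AtomicFormula.tau, h]

/-- The meaning of a signed formula in terms of that of the formula. -/
theorem Denotes.apply {m : Mark} {x : Sem} {F : Formula σ Unit} {X : Set (GAtom C)}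
    {f : (V → Ground C) → Inf (GAtom C)} (h : Denotes J (F.mark m) fun z _ => (f z).Sat X)
    (s : Sign) :
    Denotes J ((s.apply σ x F).mark m) fun z _ => (s.applyInf (f z)).Sat X := by
  have neg : ∀ {G : Formula σ Unit} {g : (V → Ground C) → Inf (GAtom C)},
      Denotes J (G.mark m) (fun z _ => (g z).Sat X) →
      Denotes J ((x.neg σ G).mark m) fun z _ => (g z).neg.Sat X := fun h => by
    cases x
    · exact h.neg.congr fun z _ => Inf.sat_neg.symm
    · exact h.sneg.congr fun z _ => Inf.sat_neg.symm
  cases s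
  · exact h
  · exact neg h
  · exact neg (neg h)

/-- Here-and-there negation looks only at `X`, just as `γ(¬F) = ¬F̂` does; `γ` of the unsigned
formula matters only without `not`. -/
theorem Denotes.gamma_apply_cli {F : Formula σ Unit} {X Y : Set (GAtom C)}
    {f : (V → Ground C) → Inf (GAtom C)} (hX : Denotes J F.hat fun z _ => (f z).Sat X)
    (hγ : Denotes J F.gamma fun z _ => (f z).HTSat X Y) (s : Sign) :
    Denotes J (s.apply σ .cli F).gamma fun z _ => (s.applyInf (f z)).HTSat X Y := by
  cases s
  · exact hγ
  · exact hX.neg.congr fun z _ => Inf.htSat_neg.symm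
  · exact hX.neg.neg.congr fun z _ => by simp [Sign.applyInf]

/-- The clause `γ(∼F) = ¬F̂ ∧ ¬NF` evaluates the negation separately in `X` and in `Y`, as the FLP
condition does with a rule body. The hypotheses `hN` and `hγ` hold for the translations of atomic
formulas and aggregate atoms. -/
theorem Denotes.gamma_apply_dlv {F : Formula σ Unit} {X Y : Set (GAtom C)}
    {f : (V → Ground C) → Inf (GAtom C)} (hX : Denotes J F.hat fun z _ => (f z).Sat X)
    (hY : Denotes J F.plain fun z _ => (f z).Sat Y) (hN : F.N = F)
    (hγ : F.gamma = .and F.plain F.hat) (s : Sign) :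
    Denotes J (s.apply σ .dlv F).gamma fun z _ =>
      (s.applyInf (f z)).Sat X ∧ (s.applyInf (f z)).Sat Y := by
  cases s
  · change Denotes J F.gamma _
    rw [hγ]
    exact (hY.and hX).congr fun z _ => and_comm
  · change Denotes J (.and F.hat.neg F.N.plain.neg) _
    rw [hN]
    exact (hX.neg.and hY.neg).congr fun z _ => by simp [Sign.applyInf]
  · change Denotes J (.and (Formula.neg (.sneg F.hat)) (Formula.neg (.neg F.N.plain))) _
    rw [hN]
    exact (hX.sneg.neg.and hY.neg.neg).congr fun z _ => by simp [Sign.applyInf]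

theorem Describes.basicLit (hJ : Describes J At) {m : Mark} {x : Sem} {l : BasicLit C V}
    {h : ∀ p ∈ l.form.preds, p ∈ σ.P} :
    Denotes J ((l.toFormula σ x h).mark m) fun z _ => (l.tau z).Sat (At m) :=
  hJ.atomicFormula.apply l.sign

theorem Describes.gamma_basicLit_cli (hJ : Describes J At) {l : BasicLit C V}
    {h : ∀ p ∈ l.form.preds, p ∈ σ.P} :
    Denotes J (l.toFormula σ .cli h).gamma fun z _ => (l.tau z).HTSat (At .hat) (At .plain) := by
  refine Denotes.gamma_apply_cli hJ.atomicFormula ?_ l.sign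
  rw [AtomicFormula.gamma_toFormula]
  exact (hJ.atomicFormula.and hJ.atomicFormula).congr
    fun z _ => AtomicFormula.htSat_tau.symm

theorem Describes.gamma_basicLit_dlv (hJ : Describes J At) {l : BasicLit C V}
    {h : ∀ p ∈ l.form.preds, p ∈ σ.P} :
    Denotes J (l.toFormula σ .dlv h).gamma fun z _ =>
      (l.tau z).Sat (At .hat) ∧ (l.tau z).Sat (At .plain) :=
  Denotes.gamma_apply_dlv hJ.atomicFormula hJ.atomicFormula AtomicFormula.N_toFormula
    AtomicFormula.gamma_toFormula l.sign

end Literals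

section Aggregates

/-! ## Aggregate elements and aggregate literals -/

theorem AggElem.mem_locals_setSym {C V : Type} [LinearOrder V] {E : AggElem C V} {Z : Finset V}
    {x : V} :
    x ∈ (E.setSym Z).locals ↔ x ∈ E.vars \ Z := by
  simp only [SetSym.locals, setSym, Finset.mem_sort, Finset.mem_sdiff, List.mem_toFinset,
    Finset.mem_inter, not_and]
  tauto

theorem PTerm.inst_congr {C V : Type} {z z' : V → Ground C} {t : PTerm C V}
    (h : ∀ x ∈ t.vars, z x = z' x) :
    t.inst z = t.inst z' := by
  cases t with
  | ground g => rfl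
  | var x => exact h x (by simp [vars])

theorem PTerm.map_inst_congr {C V : Type} {z z' : V → Ground C} {L : List (PTerm C V)}
    (h : ∀ x ∈ L.flatMap vars, z x = z' x) :
    L.map (inst z) = L.map (inst z') :=
  List.map_congr_left fun t ht => inst_congr fun x hx => h x (List.mem_flatMap.2 ⟨t, ht, hx⟩)

variable {C V : Type} [LinearOrder C]

/-- Satisfaction in the classical interpretations `X` and `Y` and in `⟨Y, X⟩`, as expressed by the
copies `m` of the symbols `s^x`. Here `X` is `At .hat` and `Y` is `At .plain`. -/
def Inf.MarkSat {A : Type} (At : Mark → Set A) : Mark → Sem → Inf A → Prop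
  | .plain, .cli, F => F.HTSat (At .hat) (At .plain)
  | m, _, F => F.Sat (At m)

/-- The instance of `E` given by `z` produces the tuple `t`, where `S` is a notion of satisfaction
of infinitary formulas. -/
def AggElem.Produces (E : AggElem C V) (S : Inf (GAtom C) → Prop) (z : V → Ground C)
    (t : List (Ground C)) : Prop :=
  t = E.terms.map (PTerm.inst z) ∧ ∀ l ∈ E.lits, S (l.tau z)

section Congr

variable {z z' : V → Ground C}

theorem BasicLit.tau_congr {l : BasicLit C V} (h : ∀ x ∈ l.form.vars, z x = z' x) :
    l.tau z = l.tau z' := by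
  obtain ⟨s, A⟩ := l
  refine congrArg s.applyInf ?_
  cases A with
  | atom A => exact congrArg (fun L => Inf.atom (A.pred, L)) (PTerm.map_inst_congr h)
  | cmp c t u =>
    have ht : t.inst z = t.inst z' := PTerm.inst_congr fun x hx => h x (List.mem_append_left _ hx)
    have hu : u.inst z = u.inst z' := PTerm.inst_congr fun x hx => h x (List.mem_append_right _ hx)
    simp only [AtomicFormula.tau]
    rw [ht, hu]

theorem AggElem.Produces.congr [DecidableEq V] {E : AggElem C V} {S : Inf (GAtom C) → Prop}
    {t : List (Ground C)} (h : E.Produces S z t) (hz : ∀ x ∈ E.vars, z x = z' x) :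
    E.Produces S z' t := by
  simp only [vars, List.mem_toFinset, List.mem_append] at hz
  refine ⟨h.1.trans (PTerm.map_inst_congr fun x hx => hz x (.inl hx)), fun l hl => ?_⟩
  rw [← BasicLit.tau_congr fun x hx => hz x (.inr (List.mem_flatMap.2 ⟨l, hl, hx⟩))]
  exact h.2 l hl

end Congr

variable [LinearOrder V]

/-- The set of tuples denoted by `E/𝐗` under the values `z` of `𝐗`. -/
def SetSym.value (e : SetSym C V) (S : Inf (GAtom C) → Prop) (z : V → Ground C) :
    Set (List (Ground C)) :=
  {t | ∃ z', EqOff e.locals z z' ∧ e.elem.Produces S z' t}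

/-- Which tuples are produced depends only on the variables of `E`, and each of these is either
local or in `𝐗`. Hence the value is a function of the arguments `𝐗` alone, as the interpretation of
a function symbol must be. -/
theorem SetSym.value_eq_setOf {e : SetSym C V} {S : Inf (GAtom C) → Prop} {z : V → Ground C} :
    e.value S z = {t | ∃ z', (∀ i, z' (e.vars.get i) = z (e.vars.get i)) ∧
      e.elem.Produces S z' t} := by
  ext t
  constructor
  · rintro ⟨z', hz, h⟩
    refine ⟨z', fun i => hz _ fun hi => ?_, h⟩
    simp [locals] at hi
  · rintro ⟨z', hz, h⟩
    refine ⟨fun x => if x ∈ e.locals then z' x else z x, fun x hx => if_neg hx,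
      h.congr fun x hx => ?_⟩
    by_cases hxl : x ∈ e.locals
    · rw [if_pos hxl]
    · rw [if_neg hxl]
      have : x ∈ e.vars := by simpa [locals, hx] using hxl
      obtain ⟨i, rfl⟩ := List.get_of_mem this
      exact hz i

theorem AggElem.image_extend (E : AggElem C V) (Z : Finset V) (S : Inf (GAtom C) → Prop)
    (z : V → Ground C) :
    (fun y => E.terms.map (PTerm.inst (E.extend Z z y))) ''
      {y | ∀ l ∈ E.lits, S (l.tau (E.extend Z z y))} = (E.setSym Z).value S z := by
  ext t
  constructor
  · rintro ⟨y, hy, rfl⟩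
    exact ⟨E.extend Z z y, fun x hx => dif_neg (mt mem_locals_setSym.2 hx), rfl, hy⟩
  · rintro ⟨z', hz, rfl, h⟩
    -- An assignment that agrees with `z` off the local variables is recovered from its restriction
    -- to them.
    have : E.extend Z z (fun x => z' x.1) = z' := by
      ext x
      unfold extend
      split_ifs with hx
      · rfl
      · exact (hz x (mt mem_locals_setSym.1 hx)).symm
    refine ⟨fun x => z' x.1, ?_, ?_⟩
    · rw [← this] at h
      exact h
    · simp only [this]
      rfl

/-- A condition on all sets that do not justify an aggregate atom, restated for one set. -/
theorem AggAtom.justifies_setOf_iff {A : AggAtom C V} {Z : Finset V} {z : V → Ground C}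
    (L : A.elem.Psi Z → Prop) :
    A.Justifies Z z {y | L y} ↔ ∀ Δ : {Δ : Set (A.elem.Psi Z) // ¬ A.Justifies Z z Δ},
      (∀ y : {y // y ∈ Δ.1}, L y.1) → ∃ y : {y // y ∉ Δ.1}, L y.1 := by
  constructor
  · rintro h ⟨Δ, hΔ⟩ hL
    by_contra hne
    refine hΔ ?_
    -- A true antecedent gives `Δ ⊆ {y | L y}` and a false consequent gives the reverse inclusion.
    have : Δ = {y | L y} := Set.ext fun y =>
      ⟨fun hy => hL ⟨y, hy⟩, fun hy => by_contra fun hyΔ => hne ⟨⟨y, hyΔ⟩, hy⟩⟩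
    rwa [this]
  · intro h
    by_contra hn
    obtain ⟨⟨y, hy⟩, hLy⟩ := h ⟨_, hn⟩ fun y => y.2
    exact hy hLy

/-- The aggregate atom holds when `S` is the notion of satisfaction for its element. -/
def AggAtom.HoldsFor (A : AggAtom C V) (Z : Finset V) (S : Inf (GAtom C) → Prop)
    (z : V → Ground C) : Prop :=
  A.cmp.Holds (A.op.eval ((A.elem.setSym Z).value S z)) (A.guard.inst z)

theorem AggAtom.sat_tau {A : AggAtom C V} {Z : Finset V} {z : V → Ground C}
    {X : Set (GAtom C)} : (A.tau Z z).Sat X ↔ A.HoldsFor Z (Inf.Sat X) z := by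
  unfold HoldsFor
  rw [← AggElem.image_extend]
  refine Iff.trans ?_ (justifies_setOf_iff _).symm
  simp only [tau, Inf.Sat, Inf.sat_conjList, List.forall_mem_map]

/-- The implication clause of `HTSat` splits the conjunction into a here-and-there family and a
classical one, and `justifies_setOf_iff` collapses the former, while `sat_tau` handles the latter.
This is why `AGG` defines the plain clingo function through `γ`. -/
theorem AggAtom.htSat_tau {A : AggAtom C V} {Z : Finset V} {z : V → Ground C}
    {X Y : Set (GAtom C)} : (A.tau Z z).HTSat X Y ↔
      A.HoldsFor Z (Inf.HTSat X Y) z ∧ A.HoldsFor Z (Inf.Sat X) z := by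
  rw [← sat_tau]
  unfold HoldsFor
  rw [← AggElem.image_extend]
  refine Iff.trans ?_ (and_congr_left' (justifies_setOf_iff _).symm)
  simp only [tau, Inf.Sat, Inf.HTSat, Inf.sat_conjList, Inf.htSat_conjList, List.forall_mem_map,
    forall_and]

variable {σ : Sig C V} {J : StandardInterp σ Mark} {At : Mark → Set (GAtom C)}

/-- The function symbols of the set symbols are interpreted as `AGG` requires. -/
def Determines (J : StandardInterp σ Mark) (At : Mark → Set (GAtom C)) : Prop :=
  ∀ m x e he z, (J.setFn m x e he fun i => z (e.vars.get i)).1 =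
    e.value (Inf.MarkSat At m x) z

theorem Determines.aggAtom (hS : Determines J At) {m : Mark} {x : Sem} {Z : Finset V}
    {A : AggAtom C V} {h : A.elem.setSym Z ∈ σ.S} :
    Denotes J ((A.toFormula σ x Z h).mark m) fun z _ => A.HoldsFor Z (Inf.MarkSat At m x) z := by
  refine denotes_cmpFormula (fun ρ z T hρ => ?_) fun _ _ _ => PTerm.eval_toTerm
  refine congrArg A.op.eval (Eq.trans ?_ (hS m x _ h z))
  exact congrArg (fun ds => (J.setFn m x _ h ds).1) (funext fun i => hρ.gen _ ⟨i, rfl⟩)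

variable {Z : Finset V} {l : Literal C V} {hl : ∀ p ∈ l.preds, p ∈ σ.P}
  {hl' : ∀ e ∈ l.setSyms Z, e ∈ σ.S}

theorem Determines.hat_literal (hS : Determines J At) (hJ : Describes J At) {x : Sem} :
    Denotes J (l.toFormula σ x Z hl hl').hat fun z _ => (l.tau Z z).Sat (At .hat) := by
  cases l with
  | basic l => exact hJ.basicLit
  | agg s A => exact (hS.aggAtom.congr fun z _ => AggAtom.sat_tau.symm).apply s

theorem Determines.gamma_literal_cli (hS : Determines J At) (hJ : Describes J At) :
    Denotes J (l.toFormula σ .cli Z hl hl').gamma fun z _ =>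
      (l.tau Z z).HTSat (At .hat) (At .plain) := by
  cases l with
  | basic l => exact hJ.gamma_basicLit_cli
  | agg s A =>
    refine Denotes.gamma_apply_cli (hS.aggAtom.congr fun z _ => AggAtom.sat_tau.symm) ?_ s
    rw [AggAtom.toFormula, gamma_cmpFormula]
    exact (hS.aggAtom.and hS.aggAtom).congr fun z _ => AggAtom.htSat_tau.symm

theorem Determines.gamma_literal_dlv (hS : Determines J At) (hJ : Describes J At) :
    Denotes J (l.toFormula σ .dlv Z hl hl').gamma fun z _ =>
      (l.tau Z z).Sat (At .hat) ∧ (l.tau Z z).Sat (At .plain) := by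
  cases l with
  | basic l => exact hJ.gamma_basicLit_dlv
  | agg s A =>
    exact Denotes.gamma_apply_dlv (hS.aggAtom.congr fun z _ => AggAtom.sat_tau.symm)
      (hS.aggAtom.congr fun z _ => AggAtom.sat_tau.symm) N_cmpFormula gamma_cmpFormula s

end Aggregates

section Rules

/-! ## Rules and programs -/

variable {C V : Type} [LinearOrder C] {σ : Sig C V} {J : StandardInterp σ Mark}
  {At : Mark → Set (GAtom C)}

theorem models_allGen {X : List V} {F : Formula σ Mark} {P : (V → Ground C) → Prop}
    (h : Denotes J F fun z _ => P z) (hF : ∀ v, ¬ (Formula.allGen X F).Free v) :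
    J.toInterp.Models (.allGen X F) ↔ ∀ z, P z :=
  ⟨fun hM z => ((h.allGen X).models_iff hF z []).1 hM z fun _ _ => rfl,
    fun hP => ((h.allGen X).models_iff hF (fun _ => .inf) []).2 fun z _ => hP z⟩

/-- A closed formula has a constant meaning. -/
theorem denotes_models {F : Formula σ Mark} (hF : ∀ v, ¬ F.Free v) :
    Denotes J F fun _ _ => J.toInterp.Models F := fun ρ z t hρ =>
  ⟨fun h ρ' => by rwa [funext₂ fun v hv => ((hF v hv).elim : ρ' v hv = ρ v hv)], fun h => h ρ⟩

theorem models_conj {L : List (Formula σ Mark)} (hL : ∀ F ∈ L, ∀ v, ¬ F.Free v) :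
    J.toInterp.Models (.conj L) ↔ ∀ F ∈ L, J.toInterp.Models F := by
  have h := denotes_conj_map (J := J) L id _ fun F hF => denotes_models (hL F hF)
  rw [List.map_id] at h
  exact h.models_iff (fun v => Formula.not_free_conj fun F hF => hL F hF v) (fun _ => .inf) []

theorem denotes_conj_attach {ι : Type*} {L : List ι} {f : {i // i ∈ L} → Formula σ Unit}
    {g : Formula σ Unit → Formula σ Mark} {P : ι → (V → Ground C) → List (Ground C) → Prop}
    (hg : ∀ L, g (.conj L) = .conj (L.map g)) (h : ∀ i, Denotes J (g (f i)) (P i.1)) :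
    Denotes J (g (.conj (L.attach.map f))) fun z t => ∀ i ∈ L, P i z t := by
  rw [hg, List.map_map]
  exact (denotes_conj_map _ (g ∘ f) _ fun i _ => h i).congr fun z t => by simp

variable [LinearOrder V]

/-- In `(γB → γH) ∧ (B̂ → Ĥ)` the second conjunct is the condition at `X`. Given it, the first
becomes the condition at `Y`, since `γB` entails `B̂` and so the hatted half of `γH` is free. -/
theorem Determines.models_gamma_rule (hS : Determines J At) (hJ : Describes J At) {x : Sem}
    {R : Rule C V} {hR : R.Over σ} : J.toInterp.Models (R.toFormula σ x hR).gamma ↔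
      R.ReductSat x (At .hat) (At .hat) ∧ R.ReductSat x (At .hat) (At .plain) := by
  have hfree : ∀ v, ¬ (R.toFormula σ x hR).gamma.Free v :=
    fun v hv => Rule.not_free_toFormula v (Formula.free_gamma hv)
  unfold Rule.toFormula at hfree ⊢
  rw [Formula.gamma_allGen] at hfree ⊢
  set B := Formula.conj (R.body.attach.map _) with hB
  have hBX : Denotes J B.hat fun z _ => ∀ l ∈ R.body, (l.tau R.globals z).Sat (At .hat) :=
    denotes_conj_attach (fun _ => Formula.mark_conj) fun l => hS.hat_literal hJ
  -- The head must be a constructor before `γ` can choose between its two clauses for implications.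
  obtain ⟨head, body⟩ := R
  cases x with
  | cli =>
    have hBγ : Denotes J B.gamma fun z _ =>
        ∀ l ∈ body, (l.tau (Rule.globals ⟨head, body⟩) z).HTSat (At .hat) (At .plain) :=
      denotes_conj_attach (fun _ => Formula.gamma_conj) fun l => hS.gamma_literal_cli hJ
    cases head with
    | none =>
      refine (models_allGen hBX.neg hfree).trans (Iff.trans (forall_congr' fun z => ?_) forall_and)
      simp only [headTau, Inf.htSat_self, Inf.htSat_bot, Inf.sat_bot]
      -- `γ` of a constraint records only `¬B̂`; persistence supplies the missing condition on the
      -- pair.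
      have persist : (∀ l ∈ body, (l.tau (Rule.globals ⟨none, body⟩) z).HTSat (At .hat)
          (At .plain)) → ∀ l ∈ body, (l.tau (Rule.globals ⟨none, body⟩) z).Sat (At .hat) :=
        fun h l hl => (h l hl).sat
      tauto
    | some A =>
      have hA := fun m => hJ.atom (m := m) (A := A) (h := hR.1 _ (by simp [Rule.preds]))
      have := (hBγ.imp ((hA .plain).and (hA .hat))).and (hBX.imp (hA .hat))
      refine (models_allGen this hfree).trans (Iff.trans (forall_congr' fun z => ?_) forall_and)
      simp only [headTau, Inf.htSat_self, Inf.HTSat, Inf.Sat]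
      tauto
  | dlv =>
    have hBγ : Denotes J B.gamma fun z _ =>
        ∀ l ∈ body, (l.tau (Rule.globals ⟨head, body⟩) z).Sat (At .hat) ∧
          (l.tau (Rule.globals ⟨head, body⟩) z).Sat (At .plain) :=
      denotes_conj_attach (fun _ => Formula.gamma_conj) fun l => hS.gamma_literal_dlv hJ
    cases head with
    | none =>
      refine (models_allGen hBX.neg hfree).trans (Iff.trans (forall_congr' fun z => ?_) forall_and)
      simp only [headTau, Inf.sat_bot]
      tauto
    | some A =>
      have hA := fun m => hJ.atom (m := m) (A := A) (h := hR.1 _ (by simp [Rule.preds]))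
      have := (hBγ.imp ((hA .plain).and (hA .hat))).and (hBX.imp (hA .hat))
      refine (models_allGen this hfree).trans (Iff.trans (forall_congr' fun z => ?_) forall_and)
      simp only [headTau, Inf.Sat, forall_and]
      tauto

theorem Determines.models_gammaTau (hS : Determines J At) (hJ : Describes J At) {x : Sem}
    {Pg : Finset (Rule C V)} {h : ∀ R ∈ Pg, R.Over σ} :
    J.toInterp.Models (gammaTau σ x Pg h) ↔ PairSat x (Pg : Set (Rule C V)) (At .hat) (At .plain)
    := by
  refine (models_conj fun F hF v hv => ?_).trans ?_
  · obtain ⟨G, hG, rfl⟩ := List.mem_map.1 hF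
    obtain ⟨R, -, rfl⟩ := List.mem_map.1 hG
    exact Rule.not_free_toFormula v (Formula.free_gamma hv)
  · simp only [tauSentences, List.forall_mem_map, Finset.mem_toList, hS.models_gamma_rule hJ,
      Finset.mem_attach, true_imp_iff, Subtype.forall, PairSat, reductSat_iff, Finset.mem_coe,
      forall_and]

end Rules

section Axioms

/-! ## The axioms `HT` and `AGG` -/

section

variable {C V : Type} {σ : Sig C V}

/-- The formula whose extension the axioms of `AGG` give to the copy `m` of `s^x`. -/
noncomputable def aggDefinition (m : Mark) (x : Sem) (e : SetSym C V) (he : e ∈ σ.S) :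
    Formula σ Mark :=
  match m, x with
  | .hat, x => (elemFormula x e he).hat
  | .plain, .cli => (elemFormula .cli e he).gamma
  | .plain, .dlv => (elemFormula .dlv e he).N.plain

theorem free_aggDefinition {m : Mark} {x : Sem} {e : SetSym C V} {he : e ∈ σ.S} {v : SVar V}
    (h : (aggDefinition m x e he).Free v) : (elemFormula x e he).Free v := by
  cases m <;> cases x
  · exact Formula.free_gamma h
  · exact Formula.free_N.1 (Formula.free_mark.1 h)
  · exact Formula.free_mark.1 h
  · exact Formula.free_mark.1 h

end

variable {C V : Type} [LinearOrder C] {σ : Sig C V} {J : StandardInterp σ Mark}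
  {At : Mark → Set (GAtom C)}

theorem models_htSentence [Infinite V] {p : PredSym C} {hp : p ∈ σ.P} :
    J.toInterp.Models (htSentence p hp) ↔ ∀ ds, J.pred .plain p hp ds → J.pred .hat p hp ds := by
  have hatom : ∀ m, Denotes J (.atom m p hp fun i => .var (s := .gen) (Infinite.natEmbedding V i))
      fun z _ => J.pred m p hp fun i => z (Infinite.natEmbedding V i) := fun m ρ z t hρ =>
    Iff.of_eq (congrArg (J.pred m p hp) (funext fun i => hρ.gen _ ⟨i, rfl⟩))
  have hfree : ∀ v, ¬ (htSentence p hp : Formula σ Mark).Free v :=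
    not_free_HT (List.mem_map.2 ⟨⟨p, hp⟩, by simp, rfl⟩)
  have himp := (hatom .plain).imp (hatom .hat)
  refine (models_allGen himp hfree).trans
    ⟨fun h ds => ?_, fun h z => h fun i => z (Infinite.natEmbedding V i)⟩
  have hinj : Function.Injective fun i : Fin p.2 => Infinite.natEmbedding V i :=
    (Infinite.natEmbedding V).injective.comp Fin.val_injective
  -- Distinct argument positions use distinct variables, so an assignment can take arbitrary
  -- prescribed values on them; `inf` elsewhere is irrelevant.
  have := h (Function.extend (fun i : Fin p.2 => Infinite.natEmbedding V i) ds fun _ => .inf)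
  simpa only [hinj.extend_apply] using this

theorem models_HT_iff [Infinite V] : (∀ F ∈ HT σ, J.toInterp.Models F) ↔
    ∀ p hp ds, J.pred .plain p hp ds → J.pred .hat p hp ds := by
  simp only [HT, List.forall_mem_map, Finset.mem_toList, Finset.mem_attach, true_imp_iff,
    Subtype.forall, models_htSentence]

theorem denotes_eq_tuple {e : SetSym C V} (he : e ∈ σ.S) {m : Mark} :
    Denotes J (.eq varT ((Term.tuple e.elem.terms.length ⟨e, he, rfl⟩
      fun i => (e.elem.terms.get i).toTerm σ Unit).mark m)) fun z t =>
        t = e.elem.terms.map (PTerm.inst z) := by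
  intro ρ z t hρ
  refine Subtype.ext_iff.trans ?_
  refine Iff.of_eq (congrArg₂ (· = ·) (hρ.tuple (.inl rfl)) ?_)
  conv_rhs => rw [← List.ofFn_get e.elem.terms, List.map_ofFn]
  exact congrArg List.ofFn (funext fun i => PTerm.eval_toTerm (hρ.restrict _))

theorem Describes.aggDefinition (hJ : Describes J At) {m : Mark} {x : Sem} {e : SetSym C V}
    {he : e ∈ σ.S} : Denotes J (aggDefinition m x e he)
      (e.elem.Produces (Inf.MarkSat At m x)) := by
  -- The three ways of reading the element formula (`hat`, `γ`, and `N` followed by `plain`) all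
  -- commute with finite conjunctions, so it suffices to treat the tuple equation and each literal.
  have key : ∀ (x' : Sem) (g : Formula σ Unit → Formula σ Mark),
      (∀ L, g (.conj L) = .conj (L.map g)) →
      Denotes J (g (.eq varT (Term.tuple e.elem.terms.length ⟨e, he, rfl⟩
        fun i => (e.elem.terms.get i).toTerm σ Unit)))
        (fun z t => t = e.elem.terms.map (PTerm.inst z)) →
      (∀ (l : BasicLit C V) (h : ∀ p ∈ l.form.preds, p ∈ σ.P),
        Denotes J (g (l.toFormula σ x' h)) fun z _ => Inf.MarkSat At m x (l.tau z)) →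
      Denotes J (g (elemFormula x' e he)) (e.elem.Produces (Inf.MarkSat At m x)) := by
    intro x' g hg heq hl
    rw [elemFormula, hg, List.map_cons, List.map_map]
    exact (heq.conj_cons (denotes_conj_map e.elem.lits.attach
      (fun l => g (l.1.toFormula σ x' fun p hp =>
        σ.closed e he p (List.mem_flatMap.2 ⟨_, l.2, hp⟩)))
      (fun l z _ => Inf.MarkSat At m x (l.1.tau z)) fun l _ => hl l.1 _)).congr
      fun z t => by simp [AggElem.Produces]
  have heq := fun m => denotes_eq_tuple (J := J) he (m := m)
  cases m with
  | hat =>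
    refine key x Formula.hat (fun _ => Formula.mark_conj) (heq _) fun l h => ?_
    cases x <;> exact hJ.basicLit
  | plain =>
    cases x with
    | cli =>
      exact key .cli Formula.gamma (fun _ => Formula.gamma_conj)
        -- `γ` doubles the tuple equation, but the equation contains no intensional symbol and both
        -- copies mean the same.
        (((heq _).and (heq _)).congr fun _ _ => and_self_iff) fun l h => hJ.gamma_basicLit_cli
    | dlv =>
      refine key .dlv (fun F => F.N.plain) (fun L => ?_) (heq _) fun l h => ?_
      · rw [Formula.N_conj, Formula.plain, Formula.mark_conj, List.map_map]
        rfl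
      · rw [BasicLit.N_toFormula_dlv]
        exact hJ.basicLit

variable [LinearOrder V]

theorem models_AGG_iff : (∀ F ∈ AGG σ, J.toInterp.Models F) ↔
    ∀ m x e he, J.toInterp.Models (aggSentence m x e he (aggDefinition (σ := σ) m x e he)) := by
  constructor
  · intro h m x e he
    refine h _ (List.mem_flatMap.2 ⟨⟨e, he⟩, by simp, ?_⟩)
    cases m <;> cases x <;> simp [aggDefinition]
  · intro h F hF
    obtain ⟨e, -, hF⟩ := List.mem_flatMap.1 hF
    simp only [List.mem_cons, List.not_mem_nil, or_false] at hF
    rcases hF with rfl | rfl | rfl | rfl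
    · exact h .hat .cli _ _
    · exact h .hat .dlv _ _
    · exact h .plain .cli _ _
    · exact h .plain .dlv _ _

theorem models_aggSentence {m : Mark} {x : Sem} {e : SetSym C V} {he : e ∈ σ.S}
    {G : Formula σ Mark} {S : Inf (GAtom C) → Prop}
    (hG : Denotes J G (e.elem.Produces S))
    (hfree : ∀ v, ¬ (aggSentence m x e he G).Free v) :
    J.toInterp.Models (aggSentence m x e he G) ↔
      ∀ z : V → Ground C, (J.setFn m x e he fun i => z (e.vars.get i)).1 = e.value S z := by
  have hmem : Denotes J (.mem varT (e.toTerm σ m x he)) fun z t =>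
      t ∈ (J.setFn m x e he fun i => z (e.vars.get i)).1 := fun ρ z t hρ => by
    refine Iff.of_eq (congrArg₂ (fun a (A : Set (List (Ground C))) => a ∈ A)
      (hρ.tuple (.inl rfl)) ?_)
    exact congrArg (fun ds => (J.setFn m x e he ds).1) (funext fun i => hρ.gen _ (.inr ⟨i, rfl⟩))
  refine (models_allGen (hmem.iff (hG.exGen e.locals)).allTuple hfree).trans
    (forall_congr' fun z => ⟨fun h => Set.ext fun t => ?_, fun h t _ => ?_⟩)
  · by_cases ht : t ∈ σ.tupleUniverse
    · exact h t ht
    · refine iff_of_false (fun h => ht (J.sets_subset _ (J.setFn m x e he _).2 h)) ?_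
      rintro ⟨z', -, rfl, -⟩
      exact ht ⟨e, he, by simp⟩
  · rw [h]
    rfl

theorem Describes.models_AGG (hJ : Describes J At) :
    (∀ F ∈ AGG σ, J.toInterp.Models F) ↔ Determines J At := by
  rw [models_AGG_iff]
  exact forall₄_congr fun m x e he => models_aggSentence hJ.aggDefinition
    (not_free_aggSentence fun v hv => free_elemFormula (free_aggDefinition hv))

end Axioms

section Main

/-! ## Strong equivalence and standard interpretations -/

/-- The ground atoms that are true in a standard interpretation, for each copy of the predicate
symbols. -/
def StandardInterp.atoms {C V : Type} {σ : Sig C V} (J : StandardInterp σ Mark) (m : Mark) :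
    Set (GAtom C) :=
  {a | ∃ hp : (a.1, a.2.length) ∈ σ.P, J.pred m (a.1, a.2.length) hp a.2.get}

theorem describes_atoms {C V : Type} {σ : Sig C V} (J : StandardInterp σ Mark) :
    Describes J J.atoms := by
  -- The length is generalized to `n` so that identifying it with `L.length` is a substitution
  -- rather than a rewrite in dependent types.
  have key : ∀ m c n (hp : (c, n) ∈ σ.P) (ds : Fin n → Ground C) (L : List (Ground C))
      (hn : L.length = n), (∀ i, ds i = L.get (i.cast hn.symm)) →
      (J.pred m (c, n) hp ds ↔ (c, L) ∈ J.atoms m) := by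
    rintro m c _ hp ds L rfl hds
    obtain rfl : ds = L.get := funext hds
    exact ⟨fun h => ⟨hp, h⟩, fun ⟨_, h⟩ => h⟩
  exact fun m p hp ds => key m p.1 p.2 hp ds _ (by simp) (by simp)

variable {C V : Type} [LinearOrder C]

/-- The standard interpretation in which the predicate symbols and their copies denote membership
in the sets `At` and the function symbols of set symbols are interpreted as `AGG` requires. -/
def StandardInterp.ofAtoms (σ : Sig C V) (At : Mark → Set (GAtom C)) : StandardInterp σ Mark where
  sets := {A | A ⊆ σ.tupleUniverse}
  sets_subset _ hA := hA
  setFn m x e he ds := ⟨{t | ∃ z : V → Ground C, (∀ i, z (e.vars.get i) = ds i) ∧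
      e.elem.Produces (Inf.MarkSat At m x) z t}, by
    rintro _ ⟨z, -, rfl, -⟩
    exact ⟨e, he, by simp⟩⟩
  pred m p _ ds := (p.1, List.ofFn ds) ∈ At m

theorem describes_ofAtoms (σ : Sig C V) (At : Mark → Set (GAtom C)) :
    Describes (.ofAtoms σ At) At := fun _ _ _ _ => Iff.rfl

variable [LinearOrder V]

theorem determines_ofAtoms (σ : Sig C V) (At : Mark → Set (GAtom C)) :
    Determines (.ofAtoms σ At) At := fun _ _ _ _ _ => SetSym.value_eq_setOf.symm

variable [Infinite V] {Pg₁ Pg₂ : Finset (Rule C V)}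

theorem models_equivSentence (J : StandardInterp (sig Pg₁ Pg₂) Mark) (x : Sem) :
    J.toInterp.Models (equivSentence x Pg₁ Pg₂) ↔
      ((∀ F ∈ HT (sig Pg₁ Pg₂), J.toInterp.Models F) ∧
        ∀ F ∈ AGG (sig Pg₁ Pg₂), J.toInterp.Models F) →
      (J.toInterp.Models (gammaTau (sig Pg₁ Pg₂) x Pg₁ (over_left Pg₁ Pg₂)) ↔
        J.toInterp.Models (gammaTau (sig Pg₁ Pg₂) x Pg₂ (over_right Pg₁ Pg₂))) := by
  have hHT : ∀ v, ¬ (Formula.conj (HT (sig Pg₁ Pg₂))).Free v :=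
    fun v => Formula.not_free_conj fun F hF => not_free_HT hF v
  have hAGG : ∀ v, ¬ (Formula.conj (AGG (sig Pg₁ Pg₂))).Free v :=
    fun v => Formula.not_free_conj fun F hF => not_free_AGG hF v
  have h₁ := not_free_gammaTau (σ := sig Pg₁ Pg₂) (x := x) (h := over_left Pg₁ Pg₂)
  have h₂ := not_free_gammaTau (σ := sig Pg₁ Pg₂) (x := x) (h := over_right Pg₁ Pg₂)
  rw [← models_conj fun F hF => not_free_HT hF, ← models_conj fun F hF => not_free_AGG hF]
  refine Denotes.models_iff (((denotes_models hHT).and (denotes_models hAGG)).imp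
    ((denotes_models h₁).iff (denotes_models h₂))) (fun v hv => ?_) (fun _ => .inf) []
  rcases hv with (hv | hv) | (hv | hv) | (hv | hv)
  exacts [hHT v hv, hAGG v hv, h₁ v hv, h₂ v hv, h₂ v hv, h₁ v hv]

/-- In the direction from interpretations to pairs, `X` and `Y` may contain atoms over predicates
outside the signature. No restriction is needed, because `Describes` speaks only of predicates in
it. -/
theorem stronglyEquivalent_iff_models (x : Sem) :
    StronglyEquivalent x (Pg₁ : Set (Rule C V)) (Pg₂ : Set (Rule C V)) ↔
      ∀ J : StandardInterp (sig Pg₁ Pg₂) Mark, J.toInterp.Models (equivSentence x Pg₁ Pg₂) := by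
  simp only [stronglyEquivalent_iff, models_equivSentence, models_HT_iff]
  constructor
  · rintro h J ⟨hHT, hAGG⟩
    have hJ := describes_atoms J
    have hS := hJ.models_AGG.1 hAGG
    rw [hS.models_gammaTau hJ, hS.models_gammaTau hJ]
    exact h _ _ fun a ⟨hp, ha⟩ => ⟨hp, hHT _ _ _ ha⟩
  · intro h X Y hYX
    let At : Mark → Set (GAtom C) := fun m => match m with
      | .plain => Y
      | .hat => X
    have hJ := describes_ofAtoms (sig Pg₁ Pg₂) At
    have hS := determines_ofAtoms (sig Pg₁ Pg₂) At
    have := h (.ofAtoms _ At) ⟨fun _ _ _ ha => hYX ha, hJ.models_AGG.2 hS⟩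
    rwa [hS.models_gammaTau hJ, hS.models_gammaTau hJ] at this

end Main

end ASP

theorem mainTheorem6 {C V : Type} [LinearOrder C] [Countable C] [Infinite C]
    [LinearOrder V] [Countable V] [Infinite V] (Pg₁ Pg₂ : Finset (ASP.Rule C V)) :
    (ASP.StronglyEquivalent .cli (Pg₁ : Set (ASP.Rule C V)) (Pg₂ : Set (ASP.Rule C V)) ↔
      ∀ J : ASP.StandardInterp (ASP.sig Pg₁ Pg₂) ASP.Mark,
        J.toInterp.Models (ASP.equivSentence .cli Pg₁ Pg₂)) ∧
    (ASP.StronglyEquivalent .dlv (Pg₁ : Set (ASP.Rule C V)) (Pg₂ : Set (ASP.Rule C V)) ↔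
      ∀ J : ASP.StandardInterp (ASP.sig Pg₁ Pg₂) ASP.Mark,
        J.toInterp.Models (ASP.equivSentence .dlv Pg₁ Pg₂)) :=
  ⟨ASP.stronglyEquivalent_iff_models .cli, ASP.stronglyEquivalent_iff_models .dlv⟩
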